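/- Let $\Omega\subset\mathbb R^2$ be a bounded Lipschitz domain whose boundary is split into disjoint relatively open parts $\Gamma_R,\Gamma_D$ with $\partial\Omega=\overline{\Gamma_R}\cup\overline{\Gamma_D}$, and let $\Omega_1,\dots,\Omega_J\subset\Omega$ be pairwise disjoint domains covering $\Omega$ up to a null set. Let $a,c$ be real measurable functions on $\Omega$ that are bounded above and below by positive constants almost everywhere, let $\omega>0$, $\kappa=\omega/c$, let $\beta\in L^\infty(\Gamma_R)$ be real-valued, $f\in L^2(\Omega)$, $g\in L^2(\Gamma_R)$, and write $(u,v)_D=\int_D u\overline v$. Put $$\mathcal C(u,v)=\int_\Omega a\nabla u\cdot\nabla\overline v\,dx-(\kappa^2u,v)_\Omega-i(\omega\beta u,v)_{\Gamma_R},\qquad F(v)=(f,v)_\Omega+(g,v)_{\Gamma_R}.$$ For each $j$ let $(b_i^j,\lambda_i^j)_{i\ge1}$ be the Dirichlet eigenpairs on $\Omega_j$, i.e. $b_i^j\in H^1_0(\Omega_j)$ and $$\int_{\Omega_j}a\nabla b_i^j\cdot\nabla\overline v\,dx=\lambda_i^j(\kappa^2b_i^j,v)_{\Omega_j}\quad\text{for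 all }v\in H_0^1(\Omega_j),$$ listed with multiplicity, with $\lambda_1^j\le\lambda_2^j\le\cdots$ and $(\kappa^2b_i^j,b_l^j)_{\Omega_j}=\delta_{il}$; extend $b_i^j$ by zero to $\Omega$. Assume that $\lambda_i^j\ne1$ for all $i,j$. Let $V_B=\bigoplus_jV^j$, where $V^j$ is the $H^1$-closed span of $\{b_i^j: i\ge1\}$, and, for $I_1,\dots,I_J\in\mathbb N_0$, let $V_{B,S}=\bigoplus_j\operatorname{span}\{b_i^j:1\le i\le I_j\}$. Let $u_B\in V_B$ and $u_{B,S}\in V_{B,S}$ satisfy $$\mathcal C(u_B,v)=F(v)\ \text{ for all }v\in V_B,\qquad \mathcal C(u_{B,S},v)=F(v)\ \text{ for all }v\in V_{B,S}.$$ Put $f_\kappa=f/\kappa^2$ and $P^j_{I_j}h=\sum_{i=1}^{I_j}(\kappa^2h,b_i^j)_{\Omega_j}b_i^j$. Then, for every $j$, the minimum of $|\lambda_i^j-1|$ and the maximum of $\lambda_i^j/|\lambda_i^j-1|^2$ over $i\ge I_j+1$ are attained. If $\lambda_*^j$ and $\lambda_\#^j$ are eigenvalues $\lambda_i^j$, $i\ge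 I_j+1$, at which this minimum and this maximum, respectively, are attained, then $$\|\kappa(u_B-u_{B,S})\|_{L^2(\Omega)}^2\le\sum_{j=1}^J\frac1{|\lambda_*^j-1|^2}\,\|\kappa(f_\kappa-P^j_{I_j}f_\kappa)\|_{L^2(\Omega_j)}^2,$$ $$\|\sqrt a\,\nabla(u_B-u_{B,S})\|_{L^2(\Omega)}^2\le\sum_{j=1}^J\frac{\lambda_\#^j}{|\lambda_\#^j-1|^2}\,\|\kappa(f_\kappa-P^j_{I_j}f_\kappa)\|_{L^2(\Omega_j)}^2 .$$ -/

import Mathlib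

open MeasureTheory
open scoped ComplexConjugate

noncomputable section

namespace ACMS

/-- The Euclidean plane. -/
abbrev Plane : Type := EuclideanSpace ℝ (Fin 2)

/-- Bounded connected open sets whose boundary is, locally and in suitable Cartesian coordinates,
the graph of a Lipschitz function, with the set lying on one side of it. -/
structure IsLipschitzDomain (Ω : Set Plane) : Prop where
  isOpen : IsOpen Ω
  isConnected : IsConnected Ω
  isBounded : Bornology.IsBounded Ω
  boundary : ∀ x ∈ frontier Ω, ∃ (Φ : Plane ≃ᵢ Plane) (K : NNReal) (h : ℝ → ℝ),
    Φ 0 = x ∧ h 0 = 0 ∧ LipschitzWith K h ∧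
      ∀ᶠ p in nhds (0 : Plane), Φ p ∈ Ω ↔ p 1 < h (p 0)

/-- `ΓR` (impedance part) and `ΓD` (Dirichlet part) are disjoint, relatively open subsets of the
boundary of `Ω` whose closures cover the boundary. -/
structure IsBoundarySplitting (Ω ΓR ΓD : Set Plane) : Prop where
  relOpenR : ∃ O : Set Plane, IsOpen O ∧ ΓR = O ∩ frontier Ω
  relOpenD : ∃ O : Set Plane, IsOpen O ∧ ΓD = O ∩ frontier Ω
  disjoint : Disjoint ΓR ΓD
  cover : frontier Ω = closure ΓR ∪ closure ΓD

/-- Decomposition of `Ω` into finitely many non-overlapping subdomains. -/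
structure IsPartition (Ω : Set Plane) {J : ℕ} (Ωs : Fin J → Set Plane) : Prop where
  isOpen : ∀ j, IsOpen (Ωs j)
  isConnected : ∀ j, IsConnected (Ωs j)
  subset : ∀ j, Ωs j ⊆ Ω
  disjoint : Pairwise fun j l => Disjoint (Ωs j) (Ωs l)
  cover : volume (Ω \ ⋃ j, Ωs j) = 0

/-- The function `w` is measurable on `Ω` and lies between two positive constants
almost everywhere on `Ω`. -/
def IsUniformlyPositive (Ω : Set Plane) (w : Plane → ℝ) : Prop :=
  AEMeasurable w (volume.restrict Ω) ∧
    ∃ wmin wmax : ℝ, 0 < wmin ∧ ∀ᵐ x ∂volume.restrict Ω, wmin ≤ w x ∧ w x ≤ wmax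

/-- The arc length measure on the boundary of `Ω`. -/
abbrev bdryMeasure (Ω : Set Plane) : Measure Plane := μH[1].restrict (frontier Ω)

/-- The gradient of a complex-valued function on the plane. -/
def grad (φ : Plane → ℂ) (x : Plane) : EuclideanSpace ℂ (Fin 2) :=
  WithLp.toLp 2 fun k => fderiv ℝ φ x (EuclideanSpace.single k 1)

/-- The ambient space `L²(Ω) × L²(Ω; ℂ²) × L²(∂Ω)`. A function of `H¹(Ω)` is recorded as the triple
of its values, its weak gradient and its boundary trace; see `H1`. -/
abbrev Triple (Ω : Set Plane) : Type :=
  Lp ℂ 2 (volume.restrict Ω) × Lp (EuclideanSpace ℂ (Fin 2)) 2 (volume.restrict Ω) ×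
    Lp ℂ 2 (bdryMeasure Ω)

namespace Triple

variable {Ω : Set Plane}

/-- The values of an `H¹` function. -/
def val (u : Triple Ω) : Plane → ℂ := u.1

/-- The weak gradient of an `H¹` function. -/
def grad (u : Triple Ω) : Plane → EuclideanSpace ℂ (Fin 2) := u.2.1

/-- The boundary trace of an `H¹` function. -/
def trace (u : Triple Ω) : Plane → ℂ := u.2.2

end Triple

/-- The triples `(φ|_Ω, ∇φ|_Ω, φ|_∂Ω)` with `φ` a smooth function with compact support in `U`. -/
def smoothTriples (Ω U : Set Plane) : Set (Triple Ω) :=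
  {u | ∃ φ : Plane → ℂ, ContDiff ℝ (⊤ : ℕ∞) φ ∧ HasCompactSupport φ ∧ tsupport φ ⊆ U ∧
    u.val =ᵐ[volume.restrict Ω] φ ∧ u.grad =ᵐ[volume.restrict Ω] grad φ ∧
    u.trace =ᵐ[bdryMeasure Ω] φ}

/-- `H¹(Ω)` for a Lipschitz domain `Ω`: the closure of the smooth functions on the closed domain.
Weak gradient and trace are the continuous extensions of gradient and restriction. -/
def H1 (Ω : Set Plane) : Submodule ℂ (Triple Ω) :=
  (Submodule.span ℂ (smoothTriples Ω Set.univ)).topologicalClosure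

/-- `H¹₀(U)` for an open subset `U` of `Ω`: the closure of the smooth functions with compact support
in `U`, regarded as a subspace of `H¹(Ω)` through extension by zero. -/
def H10 (Ω U : Set Plane) : Submodule ℂ (Triple Ω) :=
  (Submodule.span ℂ (smoothTriples Ω U)).topologicalClosure

theorem H10_le_H1 (Ω U : Set Plane) : H10 Ω U ≤ H1 Ω :=
  Submodule.topologicalClosure_mono (Submodule.span_mono
    fun _ ⟨φ, h1, h2, _, h4⟩ => ⟨φ, h1, h2, Set.subset_univ _, h4⟩)

/-- The form `∫_D a ∇u · conj ∇v`. -/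
def stiffness {Ω : Set Plane} (a : Plane → ℝ) (D : Set Plane) (u v : Triple Ω) : ℂ :=
  ∫ x in D, (a x : ℂ) * ∑ k, u.grad x k * conj (v.grad x k)

/-- The weighted inner product `(κ² u, v)_D = ∫_D κ² u conj v`. -/
def mass (κ : Plane → ℝ) (D : Set Plane) (u v : Plane → ℂ) : ℂ :=
  ∫ x in D, ((κ x : ℂ) ^ 2) * u x * conj (v x)

/-- The Helmholtz form
`∫_Ω a ∇u · conj ∇v - (κ² u, v)_Ω - i (ω β u, v)_ΓR`. -/
def helmholtzForm {Ω : Set Plane} (ΓR : Set Plane) (a κ : Plane → ℝ) (ω : ℝ) (β : Plane → ℝ)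
    (u v : Triple Ω) : ℂ :=
  stiffness a Ω u v - mass κ Ω u.val v.val
    - Complex.I * ∫ x in ΓR, (ω : ℂ) * (β x : ℂ) * u.trace x * conj (v.trace x) ∂μH[1]

/-- The load functional `F(v) = (f, v)_Ω + (g, v)_ΓR`. -/
def load {Ω : Set Plane} (ΓR : Set Plane) (f g : Plane → ℂ) (v : Triple Ω) : ℂ :=
  (∫ x in Ω, f x * conj (v.val x)) + ∫ x in ΓR, g x * conj (v.trace x) ∂μH[1]

/-- `w` satisfies the Dirichlet eigenvalue equation on `U` with eigenvalue `μ`. -/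
def IsEigen {Ω : Set Plane} (U : Set Plane) (a κ : Plane → ℝ) (μ : ℝ) (w : Triple Ω) : Prop :=
  w ∈ H10 Ω U ∧ ∀ v ∈ H10 Ω U, stiffness a U w v = (μ : ℂ) * mass κ U w.val v.val

/-- `(b i, lam i)`, `i = 0, 1, 2, …`, is an enumeration of the Dirichlet eigenpairs on `U`: the
eigenvalues are non-decreasing and repeated according to multiplicity, and the eigenfunctions are
orthonormal with respect to `(κ² ·, ·)_U`. -/
structure IsEigensystem {Ω : Set Plane} (U : Set Plane) (a κ : Plane → ℝ)
    (b : ℕ → Triple Ω) (lam : ℕ → ℝ) : Prop where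
  eigen : ∀ i, IsEigen U a κ (lam i) (b i)
  orthonormal : ∀ i l, mass κ U (b i).val (b l).val = if i = l then 1 else 0
  monotone : Monotone lam
  exhaustive : ∀ (μ : ℝ) (w : Triple Ω), IsEigen U a κ μ w →
    w ∈ Submodule.span ℂ (b '' {i | lam i = μ})

/-- The bubble space `V_B`: the sum of the (closed) spans `V^j` of all bubble functions of the
`j`-th subdomain. -/
def bubbleSpace {Ω : Set Plane} {J : ℕ} (b : Fin J → ℕ → Triple Ω) : Submodule ℂ (Triple Ω) :=
  ⨆ j, (Submodule.span ℂ (Set.range (b j))).topologicalClosure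

/-- The finite-dimensional bubble space: the first `I j` bubble functions of each subdomain. -/
def bubbleSpaceFin {Ω : Set Plane} {J : ℕ} (b : Fin J → ℕ → Triple Ω) (I : Fin J → ℕ) :
    Submodule ℂ (Triple Ω) :=
  ⨆ j, Submodule.span ℂ (b j '' {i | i < I j})

/-- `u` is a solution in `V` of the Helmholtz problem tested with `V`. -/
def IsGalerkinSolution {Ω : Set Plane} (ΓR : Set Plane) (a κ : Plane → ℝ) (ω : ℝ) (β : Plane → ℝ)
    (f g : Plane → ℂ) (V : Submodule ℂ (Triple Ω)) (u : Triple Ω) : Prop :=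
  u ∈ V ∧ ∀ v ∈ V, helmholtzForm ΓR a κ ω β u v = load ΓR f g v

/-- The projection `∑_{i < I} (κ² f, b i)_U b i`. -/
def bubbleProj {Ω : Set Plane} (U : Set Plane) (κ : Plane → ℝ) (b : ℕ → Triple Ω) (I : ℕ)
    (f : Plane → ℂ) : Plane → ℂ :=
  fun x => ∑ i ∈ Finset.range I, mass κ U f (b i).val * (b i).val x

/-- The squared norm `‖κ (f_κ - P f_κ)‖²` in `L²(U)`, where `f_κ = f / κ²` and `P` is the projection
onto the first `I` bubble functions. -/
def dataTail {Ω : Set Plane} (U : Set Plane) (κ : Plane → ℝ) (b : ℕ → Triple Ω) (I : ℕ)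
    (f : Plane → ℂ) : ℝ :=
  ∫ x in U, ‖(κ x : ℂ) *
    (f x / (κ x : ℂ) ^ 2 - bubbleProj U κ b I (fun y => f y / (κ y : ℂ) ^ 2) x)‖ ^ 2

/-- `m` is the value of the sequence `lam` at an index that minimises `|lam i - 1|` over all
`i ≥ I`. -/
def IsLamStar (lam : ℕ → ℝ) (I : ℕ) (m : ℝ) : Prop :=
  ∃ i ∈ Set.Ici I, lam i = m ∧ IsMinOn (fun i => |lam i - 1|) (Set.Ici I) i

/-- `m` is the value of the sequence `lam` at an index that maximises `lam i / |lam i - 1|²` over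
all `i ≥ I`. -/
def IsLamSharp (lam : ℕ → ℝ) (I : ℕ) (m : ℝ) : Prop :=
  ∃ i ∈ Set.Ici I, lam i = m ∧ IsMaxOn (fun i => lam i / |lam i - 1| ^ 2) (Set.Ici I) i

end ACMS

end

noncomputable section

namespace ACMS

/-! ### Parseval and Bessel estimates in Hilbert space. -/

section Hilbert

variable {H : Type*} [NormedAddCommGroup H] [InnerProductSpace ℂ H]

open scoped InnerProductSpace

/-! Write `K u = κ u` and `G u = √a ∇u`. A bubble function of the subdomain `Ω_j` has zero trace on
the boundary of `Ω` and vanishes off `Ω_j`. Hence testing with it removes both boundary integrals,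
reduces the Helmholtz form to `⟪G v, G u⟫ - ⟪K v, K u⟫`, and makes different subdomains orthogonal
for `K` and for `G`. The problem becomes diagonal: testing with `b_i^j` gives `(λ_i^j - 1) ⟪K b_i^j,
K w_j⟫ = ⟪K b_i^j, h_j⟫`, where `w_j` is the part of the solution in `V^j` and `h_j = f/κ` on `Ω_j`.

Since no eigenvalue equals 1, the two Galerkin solutions share their first `I_j` coefficients, and
beyond that the error has coefficients `⟪K b_i^j, h_j⟫ / (λ_i^j - 1)`. The `K b_i^j` are orthonormal
and the `G b_i^j` orthogonal with squared norm `λ_i^j`. A Parseval bound in each inner product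
(`norm_sq_le_of_mem_closure_span`) and Bessel's inequality for the data
(`sum_norm_inner_sq_le_tail`) give both estimates in `Decoupled.error_le`.

The extrema are attained because `λ_i^j → ∞`, which is where compactness enters. If the eigenvalues
stayed bounded, the gradients of the eigenfunctions would be bounded in `L²`, so each eigenfunction
would be close to its mean over balls of one small radius. Such a mean at a point `x` is a bounded
functional, so by Bessel the squared means of an orthonormal sequence have a sum bounded uniformly
in `x`; integrating over the bounded set `Ω` contradicts the infinite number of terms
(`H10.not_bounded_of_orthonormal`). -/

theorem inner_self_eq_norm_sq_ofReal (x : H) : ⟪x, x⟫_ℂ = ((‖x‖ ^ 2 : ℝ) : ℂ) := by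
  rw [inner_self_eq_norm_sq_to_K]
  norm_cast

/-- Parseval-type bound: a vector in the closed span of an orthogonal family is controlled by
its (unnormalised) Fourier coefficients. -/
theorem norm_sq_le_of_mem_closure_span {ι : Type*} [DecidableEq ι] {g : ι → H} {l : ι → ℝ}
    (hl : ∀ i, 0 ≤ l i) (hg : ∀ i k, ⟪g i, g k⟫_ℂ = if i = k then (l i : ℂ) else 0)
    {x : H} (hx : x ∈ closure (Submodule.span ℂ (Set.range g) : Set H)) {m : ι → ℂ}
    (hm : ∀ i, ⟪g i, x⟫_ℂ = l i * m i) {T : ℝ}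
    (hT : ∀ s : Finset ι, ∑ i ∈ s, l i * ‖m i‖ ^ 2 ≤ T) : ‖x‖ ^ 2 ≤ T := by
  have hT0 : 0 ≤ T := by simpa using hT ∅
  -- Duality: the bound is closed in `v` and holds on the span by Cauchy–Schwarz with weights `l i`;
  -- finally take `v = x`. The coefficients are never divided by `l i`, so `l i = 0` is harmless.
  have key : closure (Submodule.span ℂ (Set.range g) : Set H) ⊆
      {v | ‖⟪v, x⟫_ℂ‖ ≤ ‖v‖ * √T} := by
    refine closure_minimal ?_ (isClosed_le (by fun_prop) (by fun_prop))
    intro v hv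
    obtain ⟨c, rfl⟩ := (Finsupp.mem_span_range_iff_exists_finsupp).1 hv
    simp only [Set.mem_ofPred_eq, Finsupp.sum]
    set s := c.support
    have hnorm : ‖∑ i ∈ s, c i • g i‖ ^ 2 = ∑ i ∈ s, l i * ‖c i‖ ^ 2 := by
      rw [← Complex.ofReal_inj, ← inner_self_eq_norm_sq_ofReal, sum_inner]
      push_cast
      refine Finset.sum_congr rfl fun i hi => ?_
      simp only [inner_sum, inner_smul_left, inner_smul_right, hg]
      simp only [mul_ite, mul_zero, Finset.sum_ite_eq, if_pos hi]
      rw [← Complex.conj_mul' (c i)]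
      ring
    have hin : ⟪∑ i ∈ s, c i • g i, x⟫_ℂ = ∑ i ∈ s, l i * (conj (c i) * m i) := by
      rw [sum_inner]
      refine Finset.sum_congr rfl fun i _ => ?_
      rw [inner_smul_left, hm]
      ring
    have h1 : ‖⟪∑ i ∈ s, c i • g i, x⟫_ℂ‖ ≤ ∑ i ∈ s, (√(l i) * ‖c i‖) * (√(l i) * ‖m i‖) := by
      rw [hin]
      refine (norm_sum_le _ _).trans (Finset.sum_le_sum fun i _ => le_of_eq ?_)
      have := Real.mul_self_sqrt (hl i)
      simp only [norm_mul, Complex.norm_real, RCLike.norm_conj, Real.norm_of_nonneg (hl i)]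
      linear_combination -(‖c i‖ * ‖m i‖) * this
    refine h1.trans ((Real.sum_mul_le_sqrt_mul_sqrt _ _ _).trans ?_)
    refine mul_le_mul (le_of_eq ?_) (Real.sqrt_le_sqrt ?_) (Real.sqrt_nonneg _) (norm_nonneg _)
    · rw [← Real.sqrt_sq (norm_nonneg (∑ i ∈ s, c i • g i)), hnorm]
      simp only [mul_pow, Real.sq_sqrt (hl _)]
    · simpa only [mul_pow, Real.sq_sqrt (hl _)] using hT s
  have h := key hx
  simp only [Set.mem_ofPred_eq, inner_self_eq_norm_sq_to_K, norm_pow] at h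
  have h2 : ‖x‖ * ‖x‖ ≤ ‖x‖ * √T := by
    simpa [sq] using h
  have h3 : ‖x‖ ≤ √T := by
    rcases (norm_nonneg x).eq_or_lt with h0 | h0
    · rw [← h0]; positivity
    · exact le_of_mul_le_mul_left h2 h0
  calc ‖x‖ ^ 2 ≤ √T ^ 2 := by gcongr
    _ = T := Real.sq_sqrt hT0

theorem norm_sq_sum_of_orthogonal {J : ℕ} {x : Fin J → H}
    (h : ∀ j k, j ≠ k → ⟪x j, x k⟫_ℂ = 0) : ‖∑ j, x j‖ ^ 2 = ∑ j, ‖x j‖ ^ 2 := by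
  rw [← Complex.ofReal_inj, ← inner_self_eq_norm_sq_ofReal, sum_inner, Complex.ofReal_sum]
  refine Finset.sum_congr rfl fun i _ => ?_
  rw [inner_sum, Finset.sum_eq_single i (fun k _ hk => h i k hk.symm) (by simp),
    inner_self_eq_norm_sq_ofReal]

/-- Bessel's inequality for the part of the expansion not captured by a finite projection. -/
theorem sum_norm_inner_sq_le_tail {k : ℕ → H} (hk : Orthonormal ℂ k) (h : H) (N : ℕ)
    (s : Finset ℕ) (hs : ∀ i ∈ s, N ≤ i) :
    ∑ i ∈ s, ‖⟪k i, h⟫_ℂ‖ ^ 2 ≤ ‖h - ∑ i ∈ Finset.range N, ⟪k i, h⟫_ℂ • k i‖ ^ 2 := by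
  refine le_trans (le_of_eq (Finset.sum_congr rfl fun i hi => ?_)) (hk.sum_inner_products_le _)
  -- Subtracting the first `N` terms does not change the coefficients with index at least `N`.
  rw [inner_sub_right, inner_sum, Finset.sum_eq_zero, sub_zero]
  intro l hl
  have : i ≠ l := by
    have := hs i hi
    have := Finset.mem_range.1 hl
    omega
  rw [inner_smul_right, hk.2 this, mul_zero]

end Hilbert

theorem exists_sum_of_mem_iSup {X : Type*} [AddCommGroup X] [Module ℂ X] {J : ℕ} {V : Fin J → Submodule ℂ X} {u : X}
    (hu : u ∈ ⨆ j, V j) : ∃ w : Fin J → X, (∀ j, w j ∈ V j) ∧ ∑ j, w j = u := by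
  obtain ⟨f, hf, rfl⟩ := (Submodule.mem_iSup_iff_exists_finsupp V u).1 hu
  exact ⟨f, hf, by rw [Finsupp.sum_fintype _ _ (fun _ => rfl)]⟩

/-! ### The diagonalised Galerkin problem and its error estimates. -/

section Abstract

open scoped InnerProductSpace

variable {X H H' : Type*} [AddCommGroup X] [Module ℂ X] [TopologicalSpace X]
  [IsTopologicalAddGroup X] [ContinuousSMul ℂ X]
  [NormedAddCommGroup H] [InnerProductSpace ℂ H] [NormedAddCommGroup H'] [InnerProductSpace ℂ H']

/-- An abstract decoupled Galerkin problem. `K` and `G` play the role of the weighted value and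
weighted gradient maps. -/
structure Decoupled {J : ℕ} (K : X →L[ℂ] H) (G : X →L[ℂ] H') (b : Fin J → ℕ → X)
    (lam : Fin J → ℕ → ℝ) : Prop where
  orthK : ∀ j l, j ≠ l → ∀ u ∈ (Submodule.span ℂ (Set.range (b j))).topologicalClosure,
    ∀ v ∈ (Submodule.span ℂ (Set.range (b l))).topologicalClosure, ⟪K u, K v⟫_ℂ = 0
  orthG : ∀ j l, j ≠ l → ∀ u ∈ (Submodule.span ℂ (Set.range (b j))).topologicalClosure,
    ∀ v ∈ (Submodule.span ℂ (Set.range (b l))).topologicalClosure, ⟪G u, G v⟫_ℂ = 0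
  eigen : ∀ j i, ∀ v ∈ (Submodule.span ℂ (Set.range (b j))).topologicalClosure,
    ⟪G (b j i), G v⟫_ℂ = lam j i * ⟪K (b j i), K v⟫_ℂ
  orthonormal : ∀ j, Orthonormal ℂ fun i => K (b j i)

namespace Decoupled

variable {J : ℕ} {K : X →L[ℂ] H} {G : X →L[ℂ] H'} {b : Fin J → ℕ → X} {lam : Fin J → ℕ → ℝ}

theorem mem_closure_span (j : Fin J) (i : ℕ) :
    b j i ∈ (Submodule.span ℂ (Set.range (b j))).topologicalClosure :=
  Submodule.le_topologicalClosure _ (Submodule.subset_span ⟨i, rfl⟩)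

theorem inner_G (D : Decoupled K G b lam) (j : Fin J) (i l : ℕ) :
    ⟪G (b j i), G (b j l)⟫_ℂ = if i = l then (lam j i : ℂ) else 0 := by
  rw [D.eigen j i _ (mem_closure_span j l), orthonormal_iff_ite.1 (D.orthonormal j) i l]
  split_ifs <;> simp

theorem norm_G_sq (D : Decoupled K G b lam) (j : Fin J) (i : ℕ) :
    ‖G (b j i)‖ ^ 2 = lam j i := by
  have := D.inner_G j i i
  rw [if_pos rfl, inner_self_eq_norm_sq_ofReal] at this
  exact_mod_cast this

theorem lam_nonneg (D : Decoupled K G b lam) (j : Fin J) (i : ℕ) : 0 ≤ lam j i := by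
  rw [← D.norm_G_sq j i]; positivity

/-- The Galerkin equation determines the Fourier coefficients of the solution. -/
theorem coeff_eq (D : Decoupled K G b lam) {w : Fin J → X}
    (hw : ∀ j, w j ∈ (Submodule.span ℂ (Set.range (b j))).topologicalClosure) {h : Fin J → H}
    {j : Fin J} {i : ℕ} (hG : ⟪G (b j i), G (∑ l, w l)⟫_ℂ - ⟪K (b j i), K (∑ l, w l)⟫_ℂ =
      ⟪K (b j i), h j⟫_ℂ) :
    ((lam j i : ℂ) - 1) * ⟪K (b j i), K (w j)⟫_ℂ = ⟪K (b j i), h j⟫_ℂ := by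
  rw [← hG, map_sum, map_sum, inner_sum, inner_sum,
    Finset.sum_eq_single j
      (fun k _ hk => D.orthG j k hk.symm _ (mem_closure_span j i) _ (hw k)) (by simp),
    Finset.sum_eq_single j
      (fun k _ hk => D.orthK j k hk.symm _ (mem_closure_span j i) _ (hw k)) (by simp),
    D.eigen j i _ (hw j)]
  ring

/-- Continuity of `T` carries the closed span of the `b j i` into the closed span of their images,
where the Parseval bound applies. It serves twice: for `T = K` with `l = 1`, and for `T = G` with
`l` the eigenvalues. -/
theorem norm_sq_le {L : Type*} [NormedAddCommGroup L] [InnerProductSpace ℂ L] {T : X →L[ℂ] L}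
    {l : ℕ → ℝ} {j : Fin J} (hl : ∀ i, 0 ≤ l i)
    (horth : ∀ i k, ⟪T (b j i), T (b j k)⟫_ℂ = if i = k then (l i : ℂ) else 0)
    {e : X} (he : e ∈ (Submodule.span ℂ (Set.range (b j))).topologicalClosure) {m : ℕ → ℂ}
    (hm : ∀ i, ⟪T (b j i), T e⟫_ℂ = l i * m i)
    {I : ℕ} (hm0 : ∀ i < I, m i = 0) {S : ℝ}
    (hS : ∀ s : Finset ℕ, (∀ i ∈ s, I ≤ i) → ∑ i ∈ s, l i * ‖m i‖ ^ 2 ≤ S) :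
    ‖T e‖ ^ 2 ≤ S := by
  refine norm_sq_le_of_mem_closure_span hl horth (x := T e) ?_ hm ?_
  · have h1 : T e ∈ T '' closure (Submodule.span ℂ (Set.range (b j)) : Set X) := ⟨e, he, rfl⟩
    have h2 := image_closure_subset_closure_image T.continuous h1
    refine closure_mono ?_ h2
    rintro _ ⟨v, hv, rfl⟩
    have : T v ∈ (Submodule.span ℂ (Set.range (b j))).map (T : X →ₗ[ℂ] L) := ⟨v, hv, rfl⟩
    rw [Submodule.map_span, ← Set.range_comp] at this
    exact this
  · intro s
    rw [← Finset.sum_filter_add_sum_filter_not s (fun i => I ≤ i)]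
    rw [Finset.sum_eq_zero (s := s.filter fun i => ¬ I ≤ i), add_zero]
    · exact hS _ fun i hi => (Finset.mem_filter.1 hi).2
    · intro i hi
      rw [hm0 i (not_le.1 (Finset.mem_filter.1 hi).2)]
      simp

variable {h : Fin J → H} {I : Fin J → ℕ} {u us : X}

/-- The difference of the two Galerkin solutions splits into pieces whose Fourier coefficients
are known. -/
theorem exists_error_decomposition (D : Decoupled K G b lam) (hlam : ∀ j i, lam j i ≠ 1)
    (hu : u ∈ ⨆ j, (Submodule.span ℂ (Set.range (b j))).topologicalClosure)
    (hus : us ∈ ⨆ j, Submodule.span ℂ (b j '' {i | i < I j}))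
    (hG : ∀ j i, ⟪G (b j i), G u⟫_ℂ - ⟪K (b j i), K u⟫_ℂ = ⟪K (b j i), h j⟫_ℂ)
    (hGs : ∀ j, ∀ i < I j, ⟪G (b j i), G us⟫_ℂ - ⟪K (b j i), K us⟫_ℂ = ⟪K (b j i), h j⟫_ℂ) :
    ∃ e : Fin J → X, u - us = ∑ j, e j ∧
      (∀ j, e j ∈ (Submodule.span ℂ (Set.range (b j))).topologicalClosure) ∧
      (∀ j, ∀ i < I j, ⟪K (b j i), K (e j)⟫_ℂ = 0) ∧
      (∀ j, ∀ i, I j ≤ i → ‖⟪K (b j i), K (e j)⟫_ℂ‖ ^ 2 =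
        1 / |lam j i - 1| ^ 2 * ‖⟪K (b j i), h j⟫_ℂ‖ ^ 2) := by
  obtain ⟨w, hw, rfl⟩ := exists_sum_of_mem_iSup hu
  obtain ⟨ws, hws, rfl⟩ := exists_sum_of_mem_iSup hus
  have hws' : ∀ j, ws j ∈ (Submodule.span ℂ (Set.range (b j))).topologicalClosure := fun j =>
    Submodule.le_topologicalClosure _ (Submodule.span_mono (Set.image_subset_range _ _) (hws j))
  have hne : ∀ j i, (lam j i : ℂ) - 1 ≠ 0 := fun j i hh =>
    hlam j i (by exact_mod_cast sub_eq_zero.1 hh)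
  refine ⟨fun j => w j - ws j, by rw [Finset.sum_sub_distrib],
    fun j => sub_mem (hw j) (hws' j), fun j i hi => ?_, fun j i hi => ?_⟩
  -- Below `I j` both coefficients solve the same scalar equation with nonzero factor `lam j i - 1`.
  · have h1 := D.coeff_eq hw (hG j i)
    have h2 := D.coeff_eq hws' (hGs j i hi)
    rw [map_sub, inner_sub_right, sub_eq_zero]
    exact mul_left_cancel₀ (hne j i) (h1.trans h2.symm)
  · have h1 := D.coeff_eq hw (hG j i)
    -- From `I j` on, the discrete solution has no component along `b j i`, so the error coefficient
    -- is that of the full solution.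
    have h2 : ⟪K (b j i), K (ws j)⟫_ℂ = 0 := by
      have : Submodule.span ℂ (b j '' {l | l < I j}) ≤
          LinearMap.ker ((innerSL ℂ (K (b j i)) ∘L K : X →L[ℂ] ℂ) : X →ₗ[ℂ] ℂ) := by
        rw [Submodule.span_le]
        rintro _ ⟨l, hl, rfl⟩
        have hil : i ≠ l := by
          have : l < I j := hl
          omega
        simpa using (D.orthonormal j).2 hil
      simpa using this (hws j)
    rw [map_sub, inner_sub_right, h2, sub_zero, ← h1, norm_mul, mul_pow]
    have h3 : ‖(lam j i : ℂ) - 1‖ = |lam j i - 1| := by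
      rw [← Complex.ofReal_one, ← Complex.ofReal_sub, Complex.norm_real, Real.norm_eq_abs]
    have h4 : |lam j i - 1| ≠ 0 := abs_ne_zero.2 (sub_ne_zero.2 (hlam j i))
    rw [h3]
    field_simp

/-- The two error estimates for the abstract decoupled Galerkin problem. -/
theorem error_le (D : Decoupled K G b lam) (hlam : ∀ j i, lam j i ≠ 1)
    (hu : u ∈ ⨆ j, (Submodule.span ℂ (Set.range (b j))).topologicalClosure)
    (hus : us ∈ ⨆ j, Submodule.span ℂ (b j '' {i | i < I j}))
    (hG : ∀ j i, ⟪G (b j i), G u⟫_ℂ - ⟪K (b j i), K u⟫_ℂ = ⟪K (b j i), h j⟫_ℂ)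
    (hGs : ∀ j, ∀ i < I j, ⟪G (b j i), G us⟫_ℂ - ⟪K (b j i), K us⟫_ℂ = ⟪K (b j i), h j⟫_ℂ) :
    (∀ C : Fin J → ℝ, (∀ j i, I j ≤ i → 1 / |lam j i - 1| ^ 2 ≤ C j) →
      ‖K (u - us)‖ ^ 2 ≤ ∑ j, C j *
        ‖h j - ∑ i ∈ Finset.range (I j), ⟪K (b j i), h j⟫_ℂ • K (b j i)‖ ^ 2) ∧
    (∀ C : Fin J → ℝ, (∀ j i, I j ≤ i → lam j i / |lam j i - 1| ^ 2 ≤ C j) →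
      ‖G (u - us)‖ ^ 2 ≤ ∑ j, C j *
        ‖h j - ∑ i ∈ Finset.range (I j), ⟪K (b j i), h j⟫_ℂ • K (b j i)‖ ^ 2) := by
  obtain ⟨e, he, hmem, h0, hI⟩ := D.exists_error_decomposition hlam hu hus hG hGs
  have tail := fun j s hs => sum_norm_inner_sq_le_tail (D.orthonormal j) (h j) (I j) s hs
  constructor
  · intro C hC
    rw [he, map_sum, norm_sq_sum_of_orthogonal
      fun j k hjk => D.orthK j k hjk _ (hmem j) _ (hmem k)]
    refine Finset.sum_le_sum fun j _ => ?_
    refine norm_sq_le (l := fun _ => 1) (fun _ => zero_le_one)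
      (fun i k => by simpa using orthonormal_iff_ite.1 (D.orthonormal j) i k) (hmem j)
      (m := fun i => ⟪K (b j i), K (e j)⟫_ℂ) (fun i => by simp) (h0 j) fun s hs => ?_
    -- Nonnegativity comes from the bound at the index `i = I j`.
    have hC0 : 0 ≤ C j := le_trans (by positivity) (hC j (I j) le_rfl)
    refine le_trans ?_ (mul_le_mul_of_nonneg_left (tail j s hs) hC0)
    rw [Finset.mul_sum]
    refine Finset.sum_le_sum fun i hi => ?_
    rw [one_mul, hI j i (hs i hi)]
    exact mul_le_mul_of_nonneg_right (hC j i (hs i hi)) (by positivity)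
  · intro C hC
    rw [he, map_sum, norm_sq_sum_of_orthogonal
      fun j k hjk => D.orthG j k hjk _ (hmem j) _ (hmem k)]
    refine Finset.sum_le_sum fun j _ => ?_
    -- By the eigenvalue equation the `G`-coefficients are `lam j i` times the `K`-coefficients, so
    -- the same `m` serves with weights `lam j i`.
    refine norm_sq_le (D.lam_nonneg j) (D.inner_G j) (hmem j)
      (m := fun i => ⟪K (b j i), K (e j)⟫_ℂ) (fun i => D.eigen j i _ (hmem j)) (h0 j)
      fun s hs => ?_
    have hC0 : 0 ≤ C j := le_trans (div_nonneg (D.lam_nonneg j _) (by positivity))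
      (hC j (I j) le_rfl)
    refine le_trans ?_ (mul_le_mul_of_nonneg_left (tail j s hs) hC0)
    rw [Finset.mul_sum]
    refine Finset.sum_le_sum fun i hi => ?_
    rw [hI j i (hs i hi), ← mul_assoc, mul_one_div]
    exact mul_le_mul_of_nonneg_right (hC j i (hs i hi)) (by positivity)

end Decoupled

end Abstract

/-! ### Attainment of the minimum and the maximum for eigenvalues tending to infinity. -/

theorem exists_isLamStar {lam : ℕ → ℝ} (h : Filter.Tendsto lam Filter.atTop Filter.atTop) (I : ℕ) :
    ∃ m, IsLamStar lam I m := by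
  have h1 : Filter.Tendsto (fun i => |lam (I + i) - 1|) Filter.cofinite Filter.atTop := by
    rw [Nat.cofinite_eq_atTop]
    refine Filter.tendsto_abs_atTop_atTop.comp (Filter.tendsto_atTop_add_const_right _ (-1) ?_)
    exact h.comp (Filter.tendsto_atTop_mono (fun n => Nat.le_add_left n I) Filter.tendsto_id)
  obtain ⟨i, hi⟩ := h1.exists_forall_le
  refine ⟨_, I + i, by simp, rfl, fun k hk => ?_⟩
  obtain ⟨n, rfl⟩ := Nat.exists_eq_add_of_le (Set.mem_Ici.1 hk)
  exact hi n

/-- For `t > 1` one has `t / (t - 1)² = (t - 1)⁻¹ + (t - 1)⁻²`, so the quotients tend to 0. One of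
them is positive, and only finitely many can exceed it. -/
theorem exists_isLamSharp {lam : ℕ → ℝ} (h : Filter.Tendsto lam Filter.atTop Filter.atTop)
    (h1 : ∀ i, lam i ≠ 1) (I : ℕ) : ∃ m, IsLamSharp lam I m := by
  have hshift : Filter.Tendsto (fun i => lam (I + i)) Filter.atTop Filter.atTop :=
    h.comp (Filter.tendsto_atTop_mono (fun n => Nat.le_add_left n I) Filter.tendsto_id)
  have h0 : Filter.Tendsto (fun t : ℝ => t / |t - 1| ^ 2) Filter.atTop (nhds 0) := by
    have h2 : Filter.Tendsto (fun t : ℝ => (t - 1)⁻¹ + (t - 1)⁻¹ ^ 2) Filter.atTop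
        (nhds (0 + 0 ^ 2)) := by
      have : Filter.Tendsto (fun t : ℝ => (t - 1)⁻¹) Filter.atTop (nhds 0) :=
        tendsto_inv_atTop_zero.comp
          (Filter.tendsto_atTop_add_const_right _ (-1) Filter.tendsto_id)
      exact this.add (this.pow 2)
    simp only [ne_eq, OfNat.ofNat_ne_zero, not_false_eq_true, zero_pow, add_zero] at h2
    refine h2.congr' ?_
    filter_upwards [Filter.eventually_gt_atTop 1] with t ht
    have : t - 1 ≠ 0 := by linarith [sub_pos.2 ht] |> fun h : 0 < t - 1 => h.ne'
    rw [sq_abs]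
    field_simp
    ring
  have h2 : Filter.Tendsto (fun i => lam (I + i) / |lam (I + i) - 1| ^ 2) Filter.atTop
      (nhds 0) := h0.comp hshift
  obtain ⟨n, hn⟩ := (hshift.eventually_gt_atTop 0).exists
  have hpos : 0 < lam (I + n) / |lam (I + n) - 1| ^ 2 :=
    div_pos hn (pow_pos (abs_pos.2 (sub_ne_zero.2 (h1 _))) 2)
  obtain ⟨i, hi⟩ := Continuous.exists_forall_ge' (continuous_of_discreteTopology
    (f := fun i => lam (I + i) / |lam (I + i) - 1| ^ 2)) n (by
      rw [Filter.cocompact_eq_cofinite, Nat.cofinite_eq_atTop]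
      exact (h2.eventually_lt_const hpos).mono fun _ h => h.le)
  refine ⟨_, I + i, by simp, rfl, fun k hk => ?_⟩
  obtain ⟨n, rfl⟩ := Nat.exists_eq_add_of_le (Set.mem_Ici.1 hk)
  exact hi n

/-! ### Multiplication operators on `L²`. -/

section Weight

open scoped InnerProductSpace

variable {α E : Type*} [MeasurableSpace α] {μ : Measure α} [NormedAddCommGroup E]
  [InnerProductSpace ℂ E]

/-- Multiplication by a bounded function on `L²`. -/
def weightL (E : Type*) [NormedAddCommGroup E] [InnerProductSpace ℂ E] {w : α → ℂ}
    (hw : MemLp w ⊤ μ) : Lp E 2 μ →L[ℂ] Lp E 2 μ :=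
  (ContinuousLinearMap.lsmul ℂ ℂ : ℂ →L[ℂ] E →L[ℂ] E).holderL μ ⊤ 2 2 hw.toLp

theorem coeFn_weightL {w : α → ℂ} (hw : MemLp w ⊤ μ) (u : Lp E 2 μ) :
    weightL E hw u =ᵐ[μ] fun x => w x • u x := by
  have h := (ContinuousLinearMap.lsmul ℂ ℂ : ℂ →L[ℂ] E →L[ℂ] E).coeFn_holder (r := 2) hw.toLp u
  filter_upwards [h, hw.coeFn_toLp] with x h1 h2
  rw [← h2]
  exact h1

theorem L2_norm_sq_eq_integral (u : Lp E 2 μ) : ‖u‖ ^ 2 = ∫ x, ‖u x‖ ^ 2 ∂μ := by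
  rw [← Complex.ofReal_inj, ← inner_self_eq_norm_sq_ofReal, L2.inner_def, ← integral_complex_ofReal]
  simp only [inner_self_eq_norm_sq_ofReal]

/-- The operator is multiplication by the indicator of `S`. Its kernel is closed, so vanishing on
`S` passes from smooth functions to their closure. -/
theorem exists_clm_eq_zero_iff_ae_eq_zero_on {S : Set α} (hS : MeasurableSet S) :
    ∃ T : Lp E 2 μ →L[ℂ] Lp E 2 μ, ∀ u, T u = 0 ↔ ∀ᵐ x ∂μ, x ∈ S → u x = 0 := by
  have hw : MemLp (S.indicator fun _ => (1 : ℂ)) ⊤ μ :=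
    (memLp_top_const (1 : ℂ)).indicator hS
  refine ⟨weightL E hw, fun u => ?_⟩
  rw [Lp.eq_zero_iff_ae_eq_zero]
  constructor
  · intro h
    filter_upwards [h, coeFn_weightL hw u] with x h1 h2 hx
    rw [h2] at h1
    simpa [hx] using h1
  · intro h
    filter_upwards [h, coeFn_weightL hw u] with x h1 h2
    rw [h2]
    by_cases hx : x ∈ S
    · simp [h1 hx]
    · simp [hx]

end Weight

/-! ### Vanishing of trace, values and gradient for functions of `H¹₀(U)`. -/

section H10

variable {Ω U : Set Plane} {u : Triple Ω}

theorem H10_le_of_smoothTriples_subset {p : Submodule ℂ (Triple Ω)} (hp : IsClosed (p : Set (Triple Ω)))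
    (h : smoothTriples Ω U ⊆ p) : H10 Ω U ≤ p :=
  Submodule.topologicalClosure_minimal _ (Submodule.span_le.2 h) hp

theorem H10.trace_eq_zero (hΩ : IsOpen Ω) (hU : U ⊆ Ω) (hu : u ∈ H10 Ω U) :
    u.trace =ᵐ[bdryMeasure Ω] 0 := by
  let T : Triple Ω →L[ℂ] Lp ℂ 2 (bdryMeasure Ω) :=
    ContinuousLinearMap.snd ℂ _ _ ∘L ContinuousLinearMap.snd ℂ _ _
  have h : H10 Ω U ≤ LinearMap.ker (T : Triple Ω →ₗ[ℂ] Lp ℂ 2 (bdryMeasure Ω)) := by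
    refine H10_le_of_smoothTriples_subset T.isClosed_ker ?_
    rintro v ⟨φ, -, -, hφ, -, -, h3⟩
    change v.2.2 = 0
    rw [Lp.eq_zero_iff_ae_eq_zero]
    refine h3.trans ?_
    filter_upwards [ae_restrict_mem isClosed_frontier.measurableSet] with x hx
    by_contra hne
    exact (hΩ.frontier_eq ▸ hx).2 (hU (hφ (subset_tsupport _ hne)))
  exact (Lp.eq_zero_iff_ae_eq_zero).1 (h hu : u.2.2 = 0)

theorem H10.val_eq_zero (hU : IsOpen U) (hu : u ∈ H10 Ω U) :
    ∀ᵐ x ∂volume.restrict Ω, x ∉ U → u.val x = 0 := by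
  obtain ⟨T, hT⟩ := exists_clm_eq_zero_iff_ae_eq_zero_on (E := ℂ) (μ := volume.restrict Ω)
    hU.measurableSet.compl
  let T' : Triple Ω →L[ℂ] _ := T ∘L ContinuousLinearMap.fst ℂ _ _
  have h : H10 Ω U ≤ LinearMap.ker (T' : Triple Ω →ₗ[ℂ] Lp ℂ 2 (volume.restrict Ω)) := by
    refine H10_le_of_smoothTriples_subset T'.isClosed_ker ?_
    rintro v ⟨φ, -, -, hφ, h1, -, -⟩
    refine (hT v.1).2 (h1.mono fun x hx hxU => hx.trans ?_)
    by_contra hne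
    exact hxU (hφ (subset_tsupport _ hne))
  exact (hT u.1).1 (h hu)

theorem H10.grad_eq_zero (hU : IsOpen U) (hu : u ∈ H10 Ω U) :
    ∀ᵐ x ∂volume.restrict Ω, x ∉ U → u.grad x = 0 := by
  obtain ⟨T, hT⟩ := exists_clm_eq_zero_iff_ae_eq_zero_on (E := EuclideanSpace ℂ (Fin 2))
    (μ := volume.restrict Ω) hU.measurableSet.compl
  let T' : Triple Ω →L[ℂ] _ := T ∘L ContinuousLinearMap.fst ℂ _ _ ∘L ContinuousLinearMap.snd ℂ _ _
  have h : H10 Ω U ≤ LinearMap.ker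
      (T' : Triple Ω →ₗ[ℂ] Lp (EuclideanSpace ℂ (Fin 2)) 2 (volume.restrict Ω)) := by
    refine H10_le_of_smoothTriples_subset T'.isClosed_ker ?_
    rintro v ⟨φ, -, -, hφ, -, h2, -⟩
    refine (hT v.2.1).2 (h2.mono fun x hx hxU => hx.trans ?_)
    have h0 : fderiv ℝ φ x = 0 := by
      by_contra hne
      exact hxU (hφ (support_fderiv_subset ℝ (f := φ) hne))
    ext k
    simp [ACMS.grad, h0]
  exact (hT u.2.1).1 (h hu)

end H10

namespace IsUniformlyPositive

variable {Ω : Set Plane} {w : Plane → ℝ}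

theorem memLp_top (h : IsUniformlyPositive Ω w) :
    MemLp (fun x => (w x : ℂ)) ⊤ (volume.restrict Ω) := by
  obtain ⟨hm, wmin, wmax, h0, hw⟩ := h
  refine memLp_top_of_bound (Complex.measurable_ofReal.comp_aemeasurable hm).aestronglyMeasurable
    wmax (hw.mono fun x hx => ?_)
  rw [Complex.norm_real, Real.norm_of_nonneg (h0.le.trans hx.1)]
  exact hx.2

theorem ae_pos (h : IsUniformlyPositive Ω w) : ∀ᵐ x ∂volume.restrict Ω, 0 < w x := by
  obtain ⟨-, wmin, wmax, h0, hw⟩ := h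
  exact hw.mono fun x hx => h0.trans_le hx.1

theorem sqrt (h : IsUniformlyPositive Ω w) : IsUniformlyPositive Ω fun x => √(w x) := by
  obtain ⟨hm, wmin, wmax, h0, hw⟩ := h
  exact ⟨hm.sqrt, √wmin, √wmax, Real.sqrt_pos.2 h0, hw.mono fun x hx =>
    ⟨Real.sqrt_le_sqrt hx.1, Real.sqrt_le_sqrt hx.2⟩⟩

theorem const_div (h : IsUniformlyPositive Ω w) {t : ℝ} (ht : 0 < t) :
    IsUniformlyPositive Ω fun x => t / w x := by
  obtain ⟨hm, wmin, wmax, h0, hw⟩ := h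
  -- The maximum keeps the denominator positive, since `wmax` itself is not known to be positive.
  refine ⟨hm.const_div t, t / max wmin wmax, t / wmin, by positivity, hw.mono fun x hx => ?_⟩
  have := h0.trans_le hx.1
  refine ⟨?_, ?_⟩
  · exact div_le_div_of_nonneg_left ht.le this (hx.2.trans (le_max_right _ _))
  · exact div_le_div_of_nonneg_left ht.le h0 hx.1

end IsUniformlyPositive

/-! ### The mass and stiffness forms as `L²` inner products. -/

section Forms

open scoped InnerProductSpace

variable {Ω U : Set Plane} {a κ : Plane → ℝ}

/-- The map `u ↦ κ u` from `H¹` to `L²`. -/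
def weightedVal (hκ : IsUniformlyPositive Ω κ) :
    Triple Ω →L[ℂ] Lp ℂ 2 (volume.restrict Ω) :=
  weightL ℂ hκ.memLp_top ∘L ContinuousLinearMap.fst ℂ _ _

/-- The map `u ↦ √a ∇u` from `H¹` to `L²`. -/
def weightedGrad (ha : IsUniformlyPositive Ω a) :
    Triple Ω →L[ℂ] Lp (EuclideanSpace ℂ (Fin 2)) 2 (volume.restrict Ω) :=
  weightL _ ha.sqrt.memLp_top ∘L ContinuousLinearMap.fst ℂ _ _ ∘L ContinuousLinearMap.snd ℂ _ _

theorem coeFn_weightedVal (hκ : IsUniformlyPositive Ω κ) (u : Triple Ω) :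
    weightedVal hκ u =ᵐ[volume.restrict Ω] fun x => (κ x : ℂ) * u.val x :=
  coeFn_weightL hκ.memLp_top u.1

theorem coeFn_weightedGrad (ha : IsUniformlyPositive Ω a) (u : Triple Ω) :
    weightedGrad ha u =ᵐ[volume.restrict Ω] fun x => (√(a x) : ℂ) • u.grad x :=
  coeFn_weightL ha.sqrt.memLp_top u.2.1

theorem norm_weightedVal_sq (hκ : IsUniformlyPositive Ω κ) (u : Triple Ω) :
    ‖weightedVal hκ u‖ ^ 2 = ∫ x in Ω, ‖(κ x : ℂ) * u.val x‖ ^ 2 := by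
  rw [L2_norm_sq_eq_integral]
  exact integral_congr_ae ((coeFn_weightedVal hκ u).mono fun x hx => by simp only [hx])

theorem norm_weightedGrad_sq (ha : IsUniformlyPositive Ω a) (u : Triple Ω) :
    ‖weightedGrad ha u‖ ^ 2 = ∫ x in Ω, ‖(√(a x) : ℂ) • u.grad x‖ ^ 2 := by
  rw [L2_norm_sq_eq_integral]
  exact integral_congr_ae ((coeFn_weightedGrad ha u).mono fun x hx => by simp only [hx])

theorem setIntegral_eq_of_ae_eq_zero {F : Plane → ℂ} (hU : MeasurableSet U) (hUΩ : U ⊆ Ω)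
    (h : ∀ᵐ x ∂volume.restrict Ω, x ∉ U → F x = 0) : ∫ x in U, F x = ∫ x in Ω, F x := by
  rw [← integral_indicator hU, ← setIntegral_eq_integral_of_forall_compl_eq_zero (s := Ω)
    (fun x hx => Set.indicator_of_notMem (fun h => hx (hUΩ h)) _)]
  refine integral_congr_ae (h.mono fun x hx => ?_)
  by_cases hxU : x ∈ U
  · simp [hxU]
  · simp [hxU, hx hxU]

theorem mass_eq_inner (hκ : IsUniformlyPositive Ω κ) (u v : Triple Ω) :
    mass κ Ω u.val v.val = ⟪weightedVal hκ v, weightedVal hκ u⟫_ℂ := by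
  rw [L2.inner_def, mass]
  refine integral_congr_ae ?_
  filter_upwards [coeFn_weightedVal hκ u, coeFn_weightedVal hκ v] with x hu hv
  rw [hu, hv, RCLike.inner_apply, map_mul, Complex.conj_ofReal]
  ring

theorem stiffness_eq_inner (ha : IsUniformlyPositive Ω a) (u v : Triple Ω) :
    stiffness a Ω u v = ⟪weightedGrad ha v, weightedGrad ha u⟫_ℂ := by
  rw [L2.inner_def, stiffness]
  refine integral_congr_ae ?_
  filter_upwards [coeFn_weightedGrad ha u, coeFn_weightedGrad ha v, ha.ae_pos] with x hu hv h0
  rw [hu, hv, inner_smul_left, inner_smul_right, Complex.conj_ofReal, ← mul_assoc,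
    ← Complex.ofReal_mul, Real.mul_self_sqrt h0.le, PiLp.inner_apply]
  simp only [RCLike.inner_apply]

theorem mass_eq_of_H10 (hU : IsOpen U) (hUΩ : U ⊆ Ω) {v : Triple Ω} (hv : v ∈ H10 Ω U)
    (u : Plane → ℂ) : mass κ U u v.val = mass κ Ω u v.val :=
  setIntegral_eq_of_ae_eq_zero hU.measurableSet hUΩ
    ((H10.val_eq_zero hU hv).mono fun x hx hxU => by simp [hx hxU])

theorem stiffness_eq_of_H10 (hU : IsOpen U) (hUΩ : U ⊆ Ω) {v : Triple Ω} (hv : v ∈ H10 Ω U)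
    (u : Triple Ω) : stiffness a U u v = stiffness a Ω u v :=
  setIntegral_eq_of_ae_eq_zero hU.measurableSet hUΩ
    ((H10.grad_eq_zero hU hv).mono fun x hx hxU => by simp [hx hxU])

theorem inner_eq_zero_of_disjoint {E : Type*} [NormedAddCommGroup E] [InnerProductSpace ℂ E]
    {U' : Set Plane} (hUU : Disjoint U U') {u v : Lp E 2 (volume.restrict Ω)}
    (hu : ∀ᵐ x ∂volume.restrict Ω, x ∉ U → u x = 0)
    (hv : ∀ᵐ x ∂volume.restrict Ω, x ∉ U' → v x = 0) : ⟪u, v⟫_ℂ = 0 := by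
  rw [L2.inner_def]
  refine integral_eq_zero_of_ae ?_
  filter_upwards [hu, hv] with x h1 h2
  by_cases hx : x ∈ U
  · simp [h2 (Set.disjoint_left.1 hUU hx)]
  · simp [h1 hx]

theorem weightedVal_eq_zero (hκ : IsUniformlyPositive Ω κ) (hU : IsOpen U) {u : Triple Ω}
    (hu : u ∈ H10 Ω U) : ∀ᵐ x ∂volume.restrict Ω, x ∉ U → weightedVal hκ u x = 0 := by
  filter_upwards [coeFn_weightedVal hκ u, H10.val_eq_zero hU hu] with x h1 h2 hx
  rw [h1, h2 hx, mul_zero]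

theorem weightedGrad_eq_zero (ha : IsUniformlyPositive Ω a) (hU : IsOpen U) {u : Triple Ω}
    (hu : u ∈ H10 Ω U) : ∀ᵐ x ∂volume.restrict Ω, x ∉ U → weightedGrad ha u x = 0 := by
  filter_upwards [coeFn_weightedGrad ha u, H10.grad_eq_zero hU hu] with x h1 h2 hx
  rw [h1, h2 hx, smul_zero]

end Forms

/-! ### Eigenfunctions as an orthonormal system, decoupled between subdomains. -/

section Eigensystem

open scoped InnerProductSpace

variable {Ω U : Set Plane} {a κ : Plane → ℝ} {b : ℕ → Triple Ω} {lam : ℕ → ℝ}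

theorem IsEigensystem.closure_span_le (hb : IsEigensystem U a κ b lam) :
    (Submodule.span ℂ (Set.range b)).topologicalClosure ≤ H10 Ω U := by
  refine Submodule.topologicalClosure_minimal _ (Submodule.span_le.2 ?_)
    (Submodule.isClosed_topologicalClosure _)
  rintro _ ⟨i, rfl⟩
  exact (hb.eigen i).1

theorem IsEigen.inner_eq (ha : IsUniformlyPositive Ω a) (hκ : IsUniformlyPositive Ω κ)
    (hU : IsOpen U) (hUΩ : U ⊆ Ω) {μ : ℝ} {w : Triple Ω} (hw : IsEigen U a κ μ w)
    {v : Triple Ω} (hv : v ∈ H10 Ω U) :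
    ⟪weightedGrad ha w, weightedGrad ha v⟫_ℂ = μ * ⟪weightedVal hκ w, weightedVal hκ v⟫_ℂ := by
  have h := hw.2 v hv
  rw [stiffness_eq_of_H10 hU hUΩ hv, mass_eq_of_H10 hU hUΩ hv, stiffness_eq_inner ha,
    mass_eq_inner hκ] at h
  -- The forms put the test function in the first slot of the inner product; conjugation swaps the
  -- slots and fixes the real `μ`.
  rw [← inner_conj_symm, h, map_mul, Complex.conj_ofReal, inner_conj_symm]

theorem IsEigensystem.orthonormal_weightedVal (hκ : IsUniformlyPositive Ω κ)
    (hU : IsOpen U) (hUΩ : U ⊆ Ω) (hb : IsEigensystem U a κ b lam) :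
    Orthonormal ℂ fun i => weightedVal hκ (b i) := by
  rw [orthonormal_iff_ite]
  intro i l
  have h := hb.orthonormal l i
  rw [mass_eq_of_H10 hU hUΩ (hb.eigen i).1, mass_eq_inner hκ] at h
  rw [h]
  simp only [eq_comm]

theorem decoupled (ha : IsUniformlyPositive Ω a) (hκ : IsUniformlyPositive Ω κ) {J : ℕ}
    {Ωs : Fin J → Set Plane} (hΩs : IsPartition Ω Ωs) {b : Fin J → ℕ → Triple Ω}
    {lam : Fin J → ℕ → ℝ} (hb : ∀ j, IsEigensystem (Ωs j) a κ (b j) (lam j)) :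
    Decoupled (weightedVal hκ) (weightedGrad ha) b lam where
  orthK j l hjl _ hu _ hv := inner_eq_zero_of_disjoint (hΩs.disjoint hjl)
    (weightedVal_eq_zero hκ (hΩs.isOpen j) ((hb j).closure_span_le hu))
    (weightedVal_eq_zero hκ (hΩs.isOpen l) ((hb l).closure_span_le hv))
  orthG j l hjl _ hu _ hv := inner_eq_zero_of_disjoint (hΩs.disjoint hjl)
    (weightedGrad_eq_zero ha (hΩs.isOpen j) ((hb j).closure_span_le hu))
    (weightedGrad_eq_zero ha (hΩs.isOpen l) ((hb l).closure_span_le hv))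
  eigen j i _ hv := ((hb j).eigen i).inner_eq ha hκ (hΩs.isOpen j) (hΩs.subset j)
    ((hb j).closure_span_le hv)
  orthonormal j := (hb j).orthonormal_weightedVal hκ (hΩs.isOpen j) (hΩs.subset j)

end Eigensystem

/-! ### The load, its projection tail, and the loss of the boundary terms. -/

section Data

open scoped InnerProductSpace

variable {Ω U : Set Plane} {a κ : Plane → ℝ} {f : Plane → ℂ}

theorem memLp_indicator_div (hκ : IsUniformlyPositive Ω κ) (hU : MeasurableSet U)
    (hf : MemLp f 2 (volume.restrict Ω)) :
    MemLp (U.indicator fun x => f x / (κ x : ℂ)) 2 (volume.restrict Ω) := by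
  refine MemLp.indicator hU ?_
  have h := hf.smul (r := 2) (hκ.const_div one_pos).memLp_top
  refine h.ae_eq (Filter.Eventually.of_forall fun x => ?_)
  simp only [Pi.smul_apply', smul_eq_mul]
  push_cast
  ring

/-- The function `κ f_κ = f / κ` on `U`, extended by zero. -/
def scaledData (hκ : IsUniformlyPositive Ω κ) (hU : MeasurableSet U)
    (hf : MemLp f 2 (volume.restrict Ω)) : Lp ℂ 2 (volume.restrict Ω) :=
  (memLp_indicator_div hκ hU hf).toLp

theorem inner_scaledData (hκ : IsUniformlyPositive Ω κ) (hU : IsOpen U)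
    (hf : MemLp f 2 (volume.restrict Ω)) {v : Triple Ω} (hv : v ∈ H10 Ω U) :
    ⟪weightedVal hκ v, scaledData hκ hU.measurableSet hf⟫_ℂ = ∫ x in Ω, f x * conj (v.val x) := by
  rw [L2.inner_def]
  refine integral_congr_ae ?_
  filter_upwards [coeFn_weightedVal hκ v, (memLp_indicator_div hκ hU.measurableSet hf).coeFn_toLp,
    hκ.ae_pos, H10.val_eq_zero hU hv] with x h1 h2 h3 h4
  rw [h1, scaledData, h2, RCLike.inner_apply, map_mul, Complex.conj_ofReal]
  have h5 : (κ x : ℂ) ≠ 0 := by exact_mod_cast h3.ne'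
  by_cases hx : x ∈ U
  · rw [Set.indicator_of_mem hx]
    field_simp
  · simp [h4 hx]

theorem mass_div_sq_eq (hκ : IsUniformlyPositive Ω κ) (hU : IsOpen U) (hUΩ : U ⊆ Ω)
    (hf : MemLp f 2 (volume.restrict Ω)) {v : Triple Ω} (hv : v ∈ H10 Ω U) :
    mass κ U (fun y => f y / (κ y : ℂ) ^ 2) v.val =
      ⟪weightedVal hκ v, scaledData hκ hU.measurableSet hf⟫_ℂ := by
  rw [mass_eq_of_H10 hU hUΩ hv, inner_scaledData hκ hU hf hv]
  refine integral_congr_ae (hκ.ae_pos.mono fun x hx => ?_)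
  have h5 : (κ x : ℂ) ≠ 0 := by exact_mod_cast hx.ne'
  simp only
  field_simp

/-- Since `κ f_κ = f / κ` and both sides vanish off `U`, the tail is the residual of an orthogonal
projection in `L²(Ω)`, the form needed for Bessel's inequality. -/
theorem dataTail_eq (hκ : IsUniformlyPositive Ω κ) (hU : IsOpen U) (hUΩ : U ⊆ Ω)
    (hf : MemLp f 2 (volume.restrict Ω)) {b : ℕ → Triple Ω} (hb : ∀ i, b i ∈ H10 Ω U) (N : ℕ) :
    dataTail U κ b N f = ‖scaledData hκ hU.measurableSet hf - ∑ i ∈ Finset.range N,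
      ⟪weightedVal hκ (b i), scaledData hκ hU.measurableSet hf⟫_ℂ • weightedVal hκ (b i)‖ ^ 2 := by
  rw [L2_norm_sq_eq_integral, dataTail, ← integral_indicator hU.measurableSet,
    ← setIntegral_eq_integral_of_forall_compl_eq_zero (s := Ω)
    (fun x hx => Set.indicator_of_notMem (fun h => hx (hUΩ h)) _)]
  refine integral_congr_ae ?_
  have hsum : ∀ s : Finset ℕ, (↑(∑ i ∈ s, ⟪weightedVal hκ (b i),
      scaledData hκ hU.measurableSet hf⟫_ℂ • weightedVal hκ (b i)) : Plane → ℂ)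
      =ᵐ[volume.restrict Ω] fun x => ∑ i ∈ s, ⟪weightedVal hκ (b i),
      scaledData hκ hU.measurableSet hf⟫_ℂ • ((κ x : ℂ) * (b i).val x) := by
    intro s
    induction s using Finset.induction_on with
    | empty =>
      simp only [Finset.sum_empty]
      exact Lp.coeFn_zero ℂ 2 (volume.restrict Ω)
    | insert i s hi ih =>
      rw [Finset.sum_insert hi]
      filter_upwards [Lp.coeFn_add (⟪weightedVal hκ (b i),
        scaledData hκ hU.measurableSet hf⟫_ℂ • weightedVal hκ (b i)) (∑ i ∈ s, ⟪weightedVal hκ (b i),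
        scaledData hκ hU.measurableSet hf⟫_ℂ • weightedVal hκ (b i)), ih,
        Lp.coeFn_smul ⟪weightedVal hκ (b i), scaledData hκ hU.measurableSet hf⟫_ℂ
          (weightedVal hκ (b i)), coeFn_weightedVal hκ (b i)] with x h1 h2 h3 h4
      rw [h1, Pi.add_apply, h2, h3, Pi.smul_apply, h4, Finset.sum_insert hi]
  have hval : ∀ᵐ x ∂volume.restrict Ω, ∀ i, x ∉ U → (b i).val x = 0 :=
    ae_all_iff.2 fun i => H10.val_eq_zero hU (hb i)
  filter_upwards [Lp.coeFn_sub (scaledData hκ hU.measurableSet hf) (∑ i ∈ Finset.range N,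
    ⟪weightedVal hκ (b i), scaledData hκ hU.measurableSet hf⟫_ℂ • weightedVal hκ (b i)),
    hsum (Finset.range N), (memLp_indicator_div hκ hU.measurableSet hf).coeFn_toLp,
    hκ.ae_pos, hval] with x h1 h2 h3 h4 h5
  have h6 : (κ x : ℂ) ≠ 0 := by exact_mod_cast h4.ne'
  rw [h1, Pi.sub_apply, h2]
  rw [show scaledData hκ hU.measurableSet hf x = _ from h3]
  by_cases hx : x ∈ U
  · rw [Set.indicator_of_mem hx, Set.indicator_of_mem hx, bubbleProj]
    congr 2
    rw [mul_sub, Finset.mul_sum]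
    congr 1
    · field_simp
    · refine Finset.sum_congr rfl fun i _ => ?_
      rw [mass_div_sq_eq hκ hU hUΩ hf (hb i), smul_eq_mul]
      ring
  · rw [Set.indicator_of_notMem hx, Set.indicator_of_notMem hx]
    simp [h5 _ hx]

theorem setIntegral_trace_eq_zero {ΓR : Set Plane} (hΓ : ΓR ⊆ frontier Ω) (hΩ : IsOpen Ω)
    (hUΩ : U ⊆ Ω) {v : Triple Ω} (hv : v ∈ H10 Ω U) (F : Plane → ℂ) :
    ∫ x in ΓR, F x * conj (v.trace x) ∂μH[1] = 0 := by
  refine integral_eq_zero_of_ae ?_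
  have h : (μH[1] : Measure Plane).restrict ΓR ≤ bdryMeasure Ω := Measure.restrict_mono_set _ hΓ
  filter_upwards [ae_mono h (H10.trace_eq_zero hΩ hUΩ hv)] with x hx
  simp [hx]

/-- Tested with a function of `H¹₀(U)`, the Helmholtz problem has no boundary terms. -/
theorem helmholtz_inner_eq (ha : IsUniformlyPositive Ω a) (hκ : IsUniformlyPositive Ω κ)
    {ΓR : Set Plane} (hΓ : ΓR ⊆ frontier Ω) (hΩ : IsOpen Ω) (hU : IsOpen U) (hUΩ : U ⊆ Ω)
    (hf : MemLp f 2 (volume.restrict Ω)) {ω : ℝ} {β : Plane → ℝ} {g : Plane → ℂ}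
    {u v : Triple Ω} (hv : v ∈ H10 Ω U)
    (h : helmholtzForm ΓR a κ ω β u v = load ΓR f g v) :
    ⟪weightedGrad ha v, weightedGrad ha u⟫_ℂ - ⟪weightedVal hκ v, weightedVal hκ u⟫_ℂ =
      ⟪weightedVal hκ v, scaledData hκ hU.measurableSet hf⟫_ℂ := by
  rw [helmholtzForm, load, setIntegral_trace_eq_zero hΓ hΩ hUΩ hv,
    setIntegral_trace_eq_zero hΓ hΩ hUΩ hv, stiffness_eq_inner ha, mass_eq_inner hκ,
    mul_zero, sub_zero, add_zero] at h
  rw [h, inner_scaledData hκ hU hf hv]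

end Data

/-! ### Translation estimates for smooth functions. -/

section Translation

open scoped ENNReal

theorem sq_lintegral_le {α : Type*} [MeasurableSpace α] (μ : Measure α) {g : α → ℝ≥0∞}
    (hg : AEMeasurable g μ) : (∫⁻ x, g x ∂μ) ^ 2 ≤ μ Set.univ * ∫⁻ x, g x ^ 2 ∂μ := by
  have h := ENNReal.lintegral_mul_le_Lp_mul_Lq μ (p := 2) (q := 2)
    (by constructor <;> norm_num) (aemeasurable_const (b := (1 : ℝ≥0∞))) hg
  simp only [Pi.mul_apply, one_mul, ENNReal.one_rpow, lintegral_const] at h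
  calc (∫⁻ x, g x ∂μ) ^ 2 ≤ _ := pow_le_pow_left' h 2
    _ = _ := by
      rw [mul_pow, ← ENNReal.rpow_natCast, ← ENNReal.rpow_natCast, ← ENNReal.rpow_mul,
        ← ENNReal.rpow_mul]
      simp

theorem enorm_fderiv_apply_le (φ : Plane → ℂ) (x z : Plane) :
    ‖fderiv ℝ φ x z‖ₑ ≤ ‖z‖ₑ * ‖grad φ x‖ₑ := by
  have h : ‖fderiv ℝ φ x z‖ ≤ ‖z‖ * ‖grad φ x‖ := by
    have hz : z = ∑ k, z k • EuclideanSpace.single k (1 : ℝ) := by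
      ext k
      simp [Fin.sum_univ_two]
      fin_cases k <;> simp
    have h1 : fderiv ℝ φ x z = ∑ k, z k • grad φ x k := by
      conv_lhs => rw [hz]
      simp [grad]
    rw [h1]
    refine (norm_sum_le _ _).trans ?_
    rw [EuclideanSpace.norm_eq, EuclideanSpace.norm_eq]
    simp only [norm_smul]
    exact Real.sum_mul_le_sqrt_mul_sqrt _ _ _
  calc ‖fderiv ℝ φ x z‖ₑ = ENNReal.ofReal ‖fderiv ℝ φ x z‖ := (ofReal_norm _).symm
    _ ≤ ENNReal.ofReal (‖z‖ * ‖grad φ x‖) := ENNReal.ofReal_le_ofReal h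
    _ = _ := by rw [ENNReal.ofReal_mul (norm_nonneg _), ofReal_norm, ofReal_norm]

theorem continuous_grad {φ : Plane → ℂ} (hφ : ContDiff ℝ 1 φ) : Continuous (grad φ) := by
  refine (PiLp.continuous_toLp 2 _).comp (continuous_pi fun k => ?_)
  exact (hφ.continuous_fderiv one_ne_zero).clm_apply continuous_const

/-- Write the difference as the integral of `fderiv ℝ φ (x + t • z) z` over `t ∈ [0, 1]`, apply
Cauchy–Schwarz in `t`, exchange the integrals and use translation invariance in `x`. -/
theorem lintegral_translate_sub_sq_le {φ : Plane → ℂ} (hφ : ContDiff ℝ 1 φ) (z : Plane) :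
    ∫⁻ x, ‖φ (x + z) - φ x‖ₑ ^ 2 ≤ ‖z‖ₑ ^ 2 * ∫⁻ x, ‖grad φ x‖ₑ ^ 2 := by
  have hc : Continuous fun p : Plane × ℝ => fderiv ℝ φ (p.1 + p.2 • z) z :=
    ((hφ.continuous_fderiv one_ne_zero).comp (by fun_prop)).clm_apply continuous_const
  have hpt : ∀ x, ‖φ (x + z) - φ x‖ₑ ^ 2 ≤
      ∫⁻ t in Set.Ioc (0 : ℝ) 1, ‖z‖ₑ ^ 2 * ‖grad φ (x + t • z)‖ₑ ^ 2 := by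
    intro x
    have hcx : Continuous fun t : ℝ => fderiv ℝ φ (x + t • z) z :=
      hc.comp (by fun_prop : Continuous fun t : ℝ => (x, t))
    have hd : ∀ t : ℝ, HasDerivAt (fun t : ℝ => φ (x + t • z)) (fderiv ℝ φ (x + t • z) z) t := by
      intro t
      have h1 : HasDerivAt (fun t : ℝ => x + t • z) z t := by
        simpa using ((hasDerivAt_id t).smul_const z).const_add x
      exact ((hφ.differentiable one_ne_zero _).hasFDerivAt).comp_hasDerivAt t h1
    have h2 := intervalIntegral.integral_eq_sub_of_hasDerivAt (fun t _ => hd t)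
      (hcx.intervalIntegrable 0 1)
    simp only [one_smul, zero_smul, add_zero] at h2
    rw [← h2, intervalIntegral.integral_of_le zero_le_one]
    calc _ ≤ (∫⁻ t in Set.Ioc (0 : ℝ) 1, ‖fderiv ℝ φ (x + t • z) z‖ₑ) ^ 2 :=
          pow_le_pow_left' (enorm_integral_le_lintegral_enorm _) 2
      _ ≤ _ := sq_lintegral_le _ hcx.enorm.aemeasurable
      _ = ∫⁻ t in Set.Ioc (0 : ℝ) 1, ‖fderiv ℝ φ (x + t • z) z‖ₑ ^ 2 := by simp
      _ ≤ _ := lintegral_mono fun t => by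
          rw [← mul_pow]
          exact pow_le_pow_left' (enorm_fderiv_apply_le _ _ _) 2
  have hg := continuous_grad hφ
  calc _ ≤ ∫⁻ x, ∫⁻ t in Set.Ioc (0 : ℝ) 1, ‖z‖ₑ ^ 2 * ‖grad φ (x + t • z)‖ₑ ^ 2 :=
        lintegral_mono hpt
    _ = ∫⁻ t in Set.Ioc (0 : ℝ) 1, ∫⁻ x, ‖z‖ₑ ^ 2 * ‖grad φ (x + t • z)‖ₑ ^ 2 := by
        refine lintegral_lintegral_swap ?_
        have : Continuous fun p : Plane × ℝ => grad φ (p.1 + p.2 • z) := by fun_prop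
        exact ((this.enorm.measurable.pow_const 2).const_mul _).aemeasurable
    _ = ∫⁻ t in Set.Ioc (0 : ℝ) 1, ‖z‖ₑ ^ 2 * ∫⁻ x, ‖grad φ x‖ₑ ^ 2 := by
        refine lintegral_congr fun t => ?_
        rw [lintegral_const_mul' _ _ (by finiteness),
          lintegral_add_right_eq_self (fun x => ‖grad φ x‖ₑ ^ 2)]
    _ = _ := by simp

theorem eLpNorm_two_sq {α E : Type*} [MeasurableSpace α] [NormedAddCommGroup E] (μ : Measure α)
    (F : α → E) : eLpNorm F 2 μ ^ 2 = ∫⁻ x, ‖F x‖ₑ ^ 2 ∂μ := by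
  simpa using eLpNorm_nnreal_pow_eq_lintegral (f := F) (μ := μ) (p := 2) two_ne_zero

theorem eLpNorm_translate_sub_le {φ : Plane → ℂ} (hφ : ContDiff ℝ 1 φ) (z : Plane) :
    eLpNorm (fun x => φ (x + z) - φ x) 2 volume ≤ ‖z‖ₑ * eLpNorm (grad φ) 2 volume := by
  rw [← ENNReal.pow_le_pow_left_iff two_ne_zero, mul_pow, eLpNorm_two_sq, eLpNorm_two_sq]
  exact lintegral_translate_sub_sq_le hφ z

end Translation

/-! ### Extension of the translation estimate to `H¹₀` by density. -/

section SmoothTriples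

variable {Ω U : Set Plane}

theorem grad_add {φ ψ : Plane → ℂ} (hφ : Differentiable ℝ φ) (hψ : Differentiable ℝ ψ)
    (x : Plane) : grad (φ + ψ) x = grad φ x + grad ψ x := by
  ext k
  simp [grad, fderiv_add (hφ x) (hψ x)]

theorem grad_smul (c : ℂ) {φ : Plane → ℂ} (hφ : Differentiable ℝ φ) (x : Plane) :
    grad (c • φ) x = c • grad φ x := by
  ext k
  simp [grad, fderiv_const_smul (hφ x) c]

/-- The smooth triples form a subspace. -/
def smoothSubmodule (Ω U : Set Plane) : Submodule ℂ (Triple Ω) where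
  carrier := smoothTriples Ω U
  zero_mem' := by
    refine ⟨0, contDiff_const, HasCompactSupport.zero, by simp, Lp.coeFn_zero _ _ _, ?_,
      Lp.coeFn_zero _ _ _⟩
    have h : grad (0 : Plane → ℂ) = 0 := by
      ext x k
      simp [grad]
    rw [h]
    exact Lp.coeFn_zero _ _ _
  add_mem' := by
    rintro u v ⟨φ, h1, h2, h3, h4, h5, h6⟩ ⟨ψ, k1, k2, k3, k4, k5, k6⟩
    refine ⟨φ + ψ, h1.add k1, h2.add k2,
      (tsupport_add _ _).trans (Set.union_subset h3 k3), ?_, ?_, ?_⟩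
    · exact (Lp.coeFn_add u.1 v.1).trans (h4.add k4)
    · refine (Lp.coeFn_add u.2.1 v.2.1).trans ((h5.add k5).trans ?_)
      exact Filter.Eventually.of_forall fun x => (grad_add (h1.differentiable (by simp))
        (k1.differentiable (by simp)) x).symm
    · exact (Lp.coeFn_add u.2.2 v.2.2).trans (h6.add k6)
  smul_mem' := by
    rintro c u ⟨φ, h1, h2, h3, h4, h5, h6⟩
    refine ⟨c • φ, h1.const_smul c, h2.smul_left (f := fun _ => c),
      (closure_mono (Function.support_const_smul_subset c φ)).trans h3, ?_, ?_, ?_⟩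
    · exact (Lp.coeFn_smul c u.1).trans (h4.const_smul c)
    · refine (Lp.coeFn_smul c u.2.1).trans ((h5.const_smul c).trans ?_)
      exact Filter.Eventually.of_forall fun x =>
        (grad_smul c (h1.differentiable (by simp)) x).symm
    · exact (Lp.coeFn_smul c u.2.2).trans (h6.const_smul c)

/-- The smooth triples already form a subspace, so passing to the span adds nothing. -/
theorem H10_subset_closure : (H10 Ω U : Set (Triple Ω)) ⊆ closure (smoothTriples Ω U) :=
  closure_mono (Submodule.span_le (p := smoothSubmodule Ω U).2 subset_rfl)

open scoped ENNReal

/-- Functions of `H¹₀`, extended by zero, are Lipschitz under translation in `L²`. -/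
theorem H10.eLpNorm_translate_sub_le (hΩ : MeasurableSet Ω) (hU : U ⊆ Ω) {u : Triple Ω}
    (hu : u ∈ H10 Ω U) (z : Plane) :
    eLpNorm (fun x => Ω.indicator u.val (x + z) - Ω.indicator u.val x) 2 volume ≤
      ‖z‖ₑ * ‖u.2.1‖ₑ := by
  obtain ⟨v, hv, hlim⟩ := mem_closure_iff_seq_limit.1 (H10_subset_closure hu)
  have hmeas : AEStronglyMeasurable (Ω.indicator u.val) volume :=
    (Lp.stronglyMeasurable u.1).indicator hΩ |>.aestronglyMeasurable
  have hbound : ∀ n, eLpNorm (fun x => Ω.indicator u.val (x + z) - Ω.indicator u.val x) 2 volume ≤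
      ‖u.1 - (v n).1‖ₑ + ‖z‖ₑ * ‖(v n).2.1‖ₑ + ‖u.1 - (v n).1‖ₑ := by
    intro n
    obtain ⟨φ, h1, -, h3, h4, h5, -⟩ := hv n
    have hφ1 : ContDiff ℝ 1 φ := h1.of_le (by exact_mod_cast le_top)
    have hφ0 : ∀ x, x ∉ Ω → φ x = 0 := fun x hx => by
      by_contra hne
      exact hx (hU (h3 (subset_tsupport _ hne)))
    have hφm : AEStronglyMeasurable φ volume := h1.continuous.aestronglyMeasurable
    have hdiff : eLpNorm (Ω.indicator u.val - φ) 2 volume = ‖u.1 - (v n).1‖ₑ := by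
      have : Ω.indicator u.val - φ = Ω.indicator (u.val - φ) := by
        ext x
        by_cases hx : x ∈ Ω
        · simp [hx]
        · simp [hx, hφ0 x hx]
      rw [this, eLpNorm_indicator_eq_eLpNorm_restrict hΩ, Lp.enorm_def]
      refine eLpNorm_congr_ae ?_
      filter_upwards [h4, Lp.coeFn_sub u.1 (v n).1] with x hx hx'
      rw [hx', Pi.sub_apply, Pi.sub_apply, ← hx]
      rfl
    have hgrad : eLpNorm (grad φ) 2 volume = ‖(v n).2.1‖ₑ := by
      have : grad φ = Ω.indicator (grad φ) := by
        ext1 x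
        by_cases hx : x ∈ Ω
        · simp [hx]
        · have h0 : fderiv ℝ φ x = 0 := by
            by_contra hne
            exact hx (hU (h3 (support_fderiv_subset ℝ (f := φ) hne)))
          rw [Set.indicator_of_notMem hx]
          ext k
          simp [grad, h0]
      rw [this, eLpNorm_indicator_eq_eLpNorm_restrict hΩ, Lp.enorm_def]
      exact (eLpNorm_congr_ae h5).symm
    have htrans : eLpNorm (fun x => (Ω.indicator u.val - φ) (x + z)) 2 volume =
        ‖u.1 - (v n).1‖ₑ := by
      rw [← hdiff]
      exact eLpNorm_comp_measurePreserving (hmeas.sub hφm)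
        (measurePreserving_add_right volume z)
    have hm1 : AEStronglyMeasurable (fun x => (Ω.indicator u.val - φ) (x + z)) volume :=
      (hmeas.sub hφm).comp_measurePreserving (measurePreserving_add_right volume z)
    have hm2 : AEStronglyMeasurable (fun x => φ (x + z) - φ x) volume :=
      ((h1.continuous.comp (by fun_prop)).sub h1.continuous).aestronglyMeasurable
    have hsplit : (fun x => Ω.indicator u.val (x + z) - Ω.indicator u.val x) =
        ((fun x => (Ω.indicator u.val - φ) (x + z)) + fun x => φ (x + z) - φ x) -
          (Ω.indicator u.val - φ) := by
      ext x
      simp only [Pi.sub_apply, Pi.add_apply]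
      ring
    rw [hsplit]
    refine (eLpNorm_sub_le (hm1.add hm2) (hmeas.sub hφm) one_le_two).trans ?_
    refine add_le_add ((eLpNorm_add_le hm1 hm2 one_le_two).trans (add_le_add htrans.le ?_)) hdiff.le
    rw [← hgrad]
    exact ACMS.eLpNorm_translate_sub_le hφ1 z
  have hl1 : Filter.Tendsto (fun n => ‖u.1 - (v n).1‖ₑ) Filter.atTop (nhds 0) := by
    have h : Filter.Tendsto (fun n => u.1 - (v n).1) Filter.atTop (nhds (u.1 - u.1)) :=
      ((continuous_fst.tendsto u).comp hlim).const_sub u.1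
    simpa using h.enorm
  have hl2 : Filter.Tendsto (fun n => ‖(v n).2.1‖ₑ) Filter.atTop (nhds ‖u.2.1‖ₑ) :=
    (((continuous_fst.comp continuous_snd).tendsto u).comp hlim).enorm
  have hl := (hl1.add (ENNReal.Tendsto.const_mul hl2 (Or.inr (by finiteness :
    ‖z‖ₑ ≠ ⊤)))).add hl1
  simpa using ge_of_tendsto' hl hbound

end SmoothTriples

/-! ### Compactness through integrals over small balls. -/

section Averages

open scoped ENNReal InnerProductSpace

variable {Ω U : Set Plane}

theorem measurable_enorm_integral_ball_sq (hΩ : MeasurableSet Ω) (u : Triple Ω) (r : ℝ) :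
    Measurable fun x =>
      ‖∫ z in Metric.ball (0 : Plane) r, Ω.indicator u.val (x + z)‖ₑ ^ 2 := by
  have hw : StronglyMeasurable (Ω.indicator u.val) := (Lp.stronglyMeasurable u.1).indicator hΩ
  have h : StronglyMeasurable fun x =>
      ∫ z in Metric.ball (0 : Plane) r, Ω.indicator u.val (x + z) :=
    StronglyMeasurable.integral_prod_right (f := fun x z : Plane => Ω.indicator u.val (x + z))
      (hw.comp_measurable (measurable_fst.add measurable_snd))
  exact h.measurable.enorm.pow_const 2

/-- Integration of the zero extension over a ball is a bounded functional on `L²(Ω)`. -/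
theorem integral_ball_eq_inner (hΩ : MeasurableSet Ω) (u : Triple Ω) (x : Plane) (r : ℝ) :
    ∫ z in Metric.ball (0 : Plane) r, Ω.indicator u.val (x + z) =
      ⟪indicatorConstLp 2 (μ := volume.restrict Ω) (measurableSet_ball (x := x) (ε := r))
        (measure_ne_top_of_subset subset_rfl (Measure.restrict_apply_le _ _ |>.trans_lt
          measure_ball_lt_top).ne) (1 : ℂ), u.1⟫_ℂ := by
  rw [L2.inner_indicatorConstLp_one, ← integral_indicator measurableSet_ball,
    Measure.restrict_restrict measurableSet_ball,
    ← integral_indicator (measurableSet_ball.inter hΩ),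
    ← integral_add_left_eq_self (fun y => (Metric.ball x r ∩ Ω).indicator (⇑u.1) y) x]
  refine integral_congr_ae (Filter.Eventually.of_forall fun z => ?_)
  have h : x + z ∈ Metric.ball x r ↔ z ∈ Metric.ball (0 : Plane) r := by simp [dist_eq_norm]
  by_cases h1 : z ∈ Metric.ball (0 : Plane) r
  · by_cases h2 : x + z ∈ Ω
    · simp only [Set.indicator, h1, h2, h, Set.mem_inter_iff, and_self, if_true]
      rfl
    · simp [Set.indicator, h2]
  · simp only [Set.indicator, h, h1, Set.mem_inter_iff, false_and, if_false]

theorem lintegral_sub_average_sq_le (hΩ : MeasurableSet Ω) (hU : U ⊆ Ω) {u : Triple Ω}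
    (hu : u ∈ H10 Ω U) (r : ℝ) :
    ∫⁻ x in Ω, ‖∫ z in Metric.ball (0 : Plane) r,
        (Ω.indicator u.val (x + z) - Ω.indicator u.val x)‖ₑ ^ 2 ≤
      (volume (Metric.ball (0 : Plane) r) * (ENNReal.ofReal r * ‖u.2.1‖ₑ)) ^ 2 := by
  set V := volume (Metric.ball (0 : Plane) r)
  set w := Ω.indicator u.val
  have hw : StronglyMeasurable w := (Lp.stronglyMeasurable u.1).indicator hΩ
  have hm : Measurable fun p : Plane × Plane => ‖w (p.1 + p.2) - w p.1‖ₑ ^ 2 :=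
    (((hw.measurable.comp (measurable_fst.add measurable_snd)).sub
      (hw.measurable.comp measurable_fst)).enorm).pow_const 2
  calc _ ≤ ∫⁻ x, V * ∫⁻ z in Metric.ball (0 : Plane) r, ‖w (x + z) - w x‖ₑ ^ 2 := by
        -- The outer integral is enlarged to the whole plane, where the translation estimate lives.
        refine (lintegral_mono' Measure.restrict_le_self le_rfl).trans (lintegral_mono fun x => ?_)
        refine (pow_le_pow_left' (enorm_integral_le_lintegral_enorm _) 2).trans ?_
        refine (sq_lintegral_le _ ?_).trans (by simp [V])
        exact (((hw.measurable.comp (measurable_const_add x)).sub_const _).enorm).aemeasurable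
    _ = V * ∫⁻ x, ∫⁻ z in Metric.ball (0 : Plane) r, ‖w (x + z) - w x‖ₑ ^ 2 :=
        lintegral_const_mul' _ _ measure_ball_lt_top.ne
    _ = V * ∫⁻ z in Metric.ball (0 : Plane) r, ∫⁻ x, ‖w (x + z) - w x‖ₑ ^ 2 := by
        rw [lintegral_lintegral_swap hm.aemeasurable]
    _ ≤ V * ∫⁻ _z in Metric.ball (0 : Plane) r, (ENNReal.ofReal r * ‖u.2.1‖ₑ) ^ 2 := by
        gcongr 1
        refine setLIntegral_mono measurable_const fun z hz => ?_
        rw [← eLpNorm_two_sq]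
        refine pow_le_pow_left' ((H10.eLpNorm_translate_sub_le hΩ hU hu z).trans ?_) 2
        gcongr
        rw [← ofReal_norm]
        exact ENNReal.ofReal_le_ofReal (mem_ball_zero_iff.1 hz).le
    _ = _ := by
        rw [setLIntegral_const]
        ring

/-- The `L²` norm of a function of `H¹₀` is controlled by its local integrals and its gradient. -/
theorem volume_mul_norm_sq_le (hΩ : MeasurableSet Ω) (hU : U ⊆ Ω) {u : Triple Ω}
    (hu : u ∈ H10 Ω U) (r : ℝ) :
    (volume (Metric.ball (0 : Plane) r) * ‖u.1‖ₑ) ^ 2 ≤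
      2 * (∫⁻ x in Ω, ‖∫ z in Metric.ball (0 : Plane) r, Ω.indicator u.val (x + z)‖ₑ ^ 2) +
      2 * (volume (Metric.ball (0 : Plane) r) * (ENNReal.ofReal r * ‖u.2.1‖ₑ)) ^ 2 := by
  set V := volume (Metric.ball (0 : Plane) r) with hV
  set w := Ω.indicator u.val with hwdef
  have hVtop : V ≠ ⊤ := measure_ball_lt_top.ne
  have hw : StronglyMeasurable w := (Lp.stronglyMeasurable u.1).indicator hΩ
  have hwL : MemLp w 2 volume := (memLp_indicator_iff_restrict hΩ).2 (Lp.memLp u.1)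
  have hA := measurable_enorm_integral_ball_sq hΩ u r
  have hpt : ∀ x, V ^ 2 * ‖w x‖ₑ ^ 2 ≤
      2 * ‖∫ z in Metric.ball (0 : Plane) r, w (x + z)‖ₑ ^ 2 +
      2 * ‖∫ z in Metric.ball (0 : Plane) r, (w (x + z) - w x)‖ₑ ^ 2 := by
    intro x
    have : IsFiniteMeasure ((volume : Measure Plane).restrict (Metric.ball 0 r)) :=
      ⟨by rw [Measure.restrict_apply_univ]; exact measure_ball_lt_top⟩
    have hint : Integrable (fun z => w (x + z))
        ((volume : Measure Plane).restrict (Metric.ball 0 r)) :=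
      ((hwL.comp_measurePreserving (measurePreserving_add_left volume x)).restrict _).integrable
        one_le_two
    have hsub : ∫ z in Metric.ball (0 : Plane) r, (w (x + z) - w x) =
        (∫ z in Metric.ball (0 : Plane) r, w (x + z)) - V.toReal • w x := by
      rw [integral_sub hint (integrable_const _), setIntegral_const]
      rfl
    have hVw : V * ‖w x‖ₑ = ‖V.toReal • w x‖ₑ := by
      rw [enorm_smul, Real.enorm_of_nonneg ENNReal.toReal_nonneg, ENNReal.ofReal_toReal hVtop]
    rw [← mul_pow, hVw, hsub]
    set p := ∫ z in Metric.ball (0 : Plane) r, w (x + z)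
    set q := V.toReal • w x
    have hreal : ‖q‖ ^ 2 ≤ 2 * ‖p‖ ^ 2 + 2 * ‖p - q‖ ^ 2 := by
      have h1 : ‖q‖ ≤ ‖p‖ + ‖p - q‖ := by
        calc ‖q‖ = ‖p - (p - q)‖ := by rw [sub_sub_cancel]
          _ ≤ _ := norm_sub_le _ _
      nlinarith [norm_nonneg q, norm_nonneg p, norm_nonneg (p - q), sq_nonneg (‖p‖ - ‖p - q‖)]
    have h := ENNReal.ofReal_le_ofReal hreal
    rw [ENNReal.ofReal_add (by positivity) (by positivity), ENNReal.ofReal_mul zero_le_two,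
      ENNReal.ofReal_mul zero_le_two, ENNReal.ofReal_pow (norm_nonneg _),
      ENNReal.ofReal_pow (norm_nonneg _), ENNReal.ofReal_pow (norm_nonneg _), ofReal_norm,
      ofReal_norm, ofReal_norm] at h
    simpa using h
  have hnorm : ‖u.1‖ₑ ^ 2 = ∫⁻ x in Ω, ‖w x‖ₑ ^ 2 := by
    rw [Lp.enorm_def, eLpNorm_two_sq]
    exact setLIntegral_congr_fun hΩ fun x hx => by simp [hwdef, hx, Triple.val]
  rw [mul_pow, hnorm, ← lintegral_const_mul' _ _ (by finiteness)]
  refine (lintegral_mono hpt).trans ?_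
  rw [lintegral_add_left (hA.const_mul 2), lintegral_const_mul' _ _ (by simp),
    lintegral_const_mul' _ _ (by simp)]
  gcongr
  exact lintegral_sub_average_sq_le hΩ hU hu r

/-- Compactness of `H¹₀` in `L²`, in quantitative form: a sequence in `H¹₀` with bounded gradients
that is the image of an orthonormal sequence cannot stay away from zero. -/
theorem H10.not_bounded_of_orthonormal (hΩ : MeasurableSet Ω) (hvol : volume Ω ≠ ⊤) (hU : U ⊆ Ω)
    {H : Type*} [NormedAddCommGroup H] [InnerProductSpace ℂ H] [CompleteSpace H] {k : ℕ → H}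
    (hk : Orthonormal ℂ k) (W : H →L[ℂ] Lp ℂ 2 (volume.restrict Ω)) {u : ℕ → Triple Ω}
    (hu : ∀ i, u i ∈ H10 Ω U) (huk : ∀ i, (u i).1 = W (k i)) {m M : ℝ} (hm : 0 < m)
    (hM : 0 < M) (hmu : ∀ i, m ≤ ‖(u i).1‖) (hMu : ∀ i, ‖(u i).2.1‖ ≤ M) : False := by
  -- With this radius the oscillation term is at most `V * m / 2`, half of the lower bound `V * m`
  -- for the function itself.
  set r : ℝ := m / (2 * M) with hr
  have hr0 : 0 < r := by positivity
  set B := Metric.ball (0 : Plane) r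
  set V : ℝ := volume.real B
  have hVtop : volume B ≠ ⊤ := measure_ball_lt_top.ne
  have hV0 : 0 < V := ENNReal.toReal_pos (Metric.measure_ball_pos volume 0 hr0).ne' hVtop
  have hVof : volume B = ENNReal.ofReal V := (ENNReal.ofReal_toReal hVtop).symm
  let A : ℕ → Plane → ℂ := fun i x => ∫ z in B, Ω.indicator (u i).val (x + z)
  have hAmeas : ∀ i, Measurable fun x => ‖A i x‖ₑ ^ 2 := fun i =>
    measurable_enorm_integral_ball_sq hΩ (u i) r
  -- Here `(V m)² ≤ 2 ∫ |A i|² + 2 (V m / 2)²`, which leaves `(V m)² / 4`.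
  have hlow : ∀ i, ENNReal.ofReal ((V * m) ^ 2 / 4) ≤ ∫⁻ x in Ω, ‖A i x‖ₑ ^ 2 := by
    intro i
    rcases eq_or_ne (∫⁻ x in Ω, ‖A i x‖ₑ ^ 2) ⊤ with h | h
    · rw [h]; exact le_top
    have h1 := volume_mul_norm_sq_le hΩ hU (hu i) r
    have h2 : ENNReal.ofReal ((V * m) ^ 2) ≤ 2 * (∫⁻ x in Ω, ‖A i x‖ₑ ^ 2) +
        2 * ENNReal.ofReal ((V * (r * M)) ^ 2) := by
      refine le_trans ?_ (h1.trans ?_)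
      · rw [hVof, ENNReal.ofReal_pow (by positivity), ENNReal.ofReal_mul hV0.le]
        gcongr
        rw [← ofReal_norm]
        exact ENNReal.ofReal_le_ofReal (hmu i)
      · rw [ENNReal.ofReal_pow (by positivity), ENNReal.ofReal_mul hV0.le,
          ENNReal.ofReal_mul hr0.le, ← hVof]
        gcongr
        rw [← ofReal_norm]
        exact ENNReal.ofReal_le_ofReal (hMu i)
    rw [← ENNReal.ofReal_toReal h] at h2 ⊢
    have h2' : (2 : ℝ≥0∞) = ENNReal.ofReal 2 := (ENNReal.ofReal_ofNat 2).symm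
    simp only [h2'] at h2
    rw [← ENNReal.ofReal_mul zero_le_two,
      ← ENNReal.ofReal_mul zero_le_two, ← ENNReal.ofReal_add (by positivity) (by positivity),
      ENNReal.ofReal_le_ofReal_iff (by positivity)] at h2
    refine ENNReal.ofReal_le_ofReal ?_
    have h3 : r * M = m / 2 := by rw [hr]; field_simp
    rw [h3] at h2
    nlinarith
  -- For fixed `x`, `A i x` is up to conjugation a Fourier coefficient, with respect to `k`, of the
  -- vector `W* ξ`, where `ξ` is the indicator of the ball about `x`; Bessel bounds the sum
  -- independently of `N`.
  have hup : ∀ N : ℕ, ∀ x, ∑ i ∈ Finset.range N, ‖A i x‖ₑ ^ 2 ≤ ENNReal.ofReal (‖W‖ ^ 2 * V) := by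
    intro N x
    have hfin : (volume.restrict Ω) (Metric.ball x r) ≠ ⊤ :=
      (Measure.restrict_apply_le _ _ |>.trans_lt measure_ball_lt_top).ne
    set ξ := indicatorConstLp 2 (μ := volume.restrict Ω) (measurableSet_ball (x := x) (ε := r))
      hfin (1 : ℂ)
    have hA : ∀ i, ‖A i x‖ = ‖⟪k i, ContinuousLinearMap.adjoint W ξ⟫_ℂ‖ := by
      intro i
      rw [ContinuousLinearMap.adjoint_inner_right, ← huk, norm_inner_symm]
      exact congrArg _ (integral_ball_eq_inner hΩ (u i) x r)
    have hξ : ‖ξ‖ ^ 2 ≤ V := by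
      rw [norm_indicatorConstLp two_ne_zero (by simp)]
      simp only [norm_one, one_mul, ENNReal.toReal_ofNat]
      rw [← Real.sqrt_eq_rpow, Real.sq_sqrt measureReal_nonneg]
      have : volume.real (Metric.ball x r) = V := by
        simp only [V, B, Measure.real, Measure.addHaar_ball_center volume x]
      rw [← this]
      exact ENNReal.toReal_mono measure_ball_lt_top.ne (Measure.restrict_apply_le _ _)
    have hsum : ∑ i ∈ Finset.range N, ‖A i x‖ ^ 2 ≤ ‖W‖ ^ 2 * V := by
      simp only [hA]
      refine (hk.sum_inner_products_le _).trans ?_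
      calc _ ≤ (‖W‖ * ‖ξ‖) ^ 2 := by
            gcongr
            refine (ContinuousLinearMap.le_opNorm _ _).trans ?_
            rw [LinearIsometryEquiv.norm_map]
        _ ≤ _ := by
            rw [mul_pow]
            gcongr
    refine le_trans (le_of_eq ?_) (ENNReal.ofReal_le_ofReal hsum)
    rw [ENNReal.ofReal_sum_of_nonneg fun i _ => by positivity]
    refine Finset.sum_congr rfl fun i _ => ?_
    rw [ENNReal.ofReal_pow (norm_nonneg _), ofReal_norm]
  have hfinal : ∀ N : ℕ, (N : ℝ≥0∞) * ENNReal.ofReal ((V * m) ^ 2 / 4) ≤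
      ENNReal.ofReal (‖W‖ ^ 2 * V) * volume Ω := by
    intro N
    calc _ = ∑ _i ∈ Finset.range N, ENNReal.ofReal ((V * m) ^ 2 / 4) := by simp
      _ ≤ ∑ i ∈ Finset.range N, ∫⁻ x in Ω, ‖A i x‖ₑ ^ 2 := Finset.sum_le_sum fun i _ => hlow i
      _ = ∫⁻ x in Ω, ∑ i ∈ Finset.range N, ‖A i x‖ₑ ^ 2 :=
          (lintegral_finsetSum _ fun i _ => hAmeas i).symm
      _ ≤ ∫⁻ _x in Ω, ENNReal.ofReal (‖W‖ ^ 2 * V) := lintegral_mono (hup N)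
      _ = _ := setLIntegral_const _ _
  have hpos : ENNReal.ofReal ((V * m) ^ 2 / 4) ≠ 0 := by
    simp only [ne_eq, ENNReal.ofReal_eq_zero, not_le]
    positivity
  obtain ⟨N, hN⟩ := ENNReal.exists_nat_mul_gt hpos
    (ENNReal.mul_ne_top ENNReal.ofReal_ne_top hvol : ENNReal.ofReal (‖W‖ ^ 2 * V) * volume Ω ≠ ⊤)
  exact absurd (hfinal N) (not_le.2 hN)

end Averages

/-! ### Divergence of the Dirichlet eigenvalues. -/

section Growth

variable {Ω U : Set Plane} {a κ : Plane → ℝ} {b : ℕ → Triple Ω} {lam : ℕ → ℝ}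

theorem weightL_inv_weightedVal (hκ : IsUniformlyPositive Ω κ) (u : Triple Ω) :
    weightL ℂ (hκ.const_div one_pos).memLp_top (weightedVal hκ u) = u.1 := by
  refine Lp.ext ?_
  filter_upwards [coeFn_weightL (hκ.const_div one_pos).memLp_top (weightedVal hκ u),
    coeFn_weightedVal hκ u, hκ.ae_pos] with x h1 h2 h3
  have h5 : (κ x : ℂ) ≠ 0 := by exact_mod_cast h3.ne'
  rw [h1, h2, smul_eq_mul]
  push_cast
  rw [← mul_assoc, one_div_mul_cancel h5, one_mul]
  rfl

theorem weightL_inv_weightedGrad (ha : IsUniformlyPositive Ω a) (u : Triple Ω) :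
    weightL _ (ha.sqrt.const_div one_pos).memLp_top (weightedGrad ha u) = u.2.1 := by
  refine Lp.ext ?_
  filter_upwards [coeFn_weightL (ha.sqrt.const_div one_pos).memLp_top (weightedGrad ha u),
    coeFn_weightedGrad ha u, ha.sqrt.ae_pos] with x h1 h2 h3
  have h5 : (√(a x) : ℂ) ≠ 0 := by exact_mod_cast h3.ne'
  rw [h1, h2, smul_smul]
  push_cast
  rw [one_div_mul_cancel h5, one_smul]
  rfl

/-- The Dirichlet eigenvalues tend to infinity. -/
theorem IsEigensystem.tendsto_atTop (ha : IsUniformlyPositive Ω a) (hκ : IsUniformlyPositive Ω κ)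
    (hΩ : MeasurableSet Ω) (hvol : volume Ω ≠ ⊤) (hU : IsOpen U) (hUΩ : U ⊆ Ω)
    (hb : IsEigensystem U a κ b lam) : Filter.Tendsto lam Filter.atTop Filter.atTop := by
  refine Filter.tendsto_atTop_atTop_of_monotone hb.monotone fun Λ => ?_
  by_contra! hΛ
  have hk := hb.orthonormal_weightedVal hκ hU hUΩ
  have hmem := fun i => (hb.eigen i).1
  have hG : ∀ i, ‖weightedGrad ha (b i)‖ ^ 2 ≤ Λ := by
    intro i
    have h := (hb.eigen i).inner_eq ha hκ hU hUΩ (hmem i)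
    rw [inner_self_eq_norm_sq_ofReal, inner_self_eq_norm_sq_ofReal, hk.1 i] at h
    have h' : ‖weightedGrad ha (b i)‖ ^ 2 = lam i := by
      have : ((‖weightedGrad ha (b i)‖ ^ 2 : ℝ) : ℂ) = (lam i : ℂ) := by simpa using h
      exact_mod_cast this
    rw [h']
    exact (hΛ i).le
  set C := ‖weightL (EuclideanSpace ℂ (Fin 2)) (ha.sqrt.const_div one_pos).memLp_top‖
  set D := ‖weightL ℂ hκ.memLp_top‖
  -- The operator `W` is division by `κ`. The added ones in `m` and `M` only ensure positivity.
  refine H10.not_bounded_of_orthonormal hΩ hvol hUΩ hk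
    (weightL ℂ (hκ.const_div one_pos).memLp_top) hmem
    (fun i => (weightL_inv_weightedVal hκ (b i)).symm) (m := 1 / (D + 1)) (M := C * √Λ + 1)
    (by positivity) (by positivity) (fun i => ?_) (fun i => ?_)
  · rw [div_le_iff₀ (by positivity)]
    have h1 : ‖weightedVal hκ (b i)‖ ≤ D * ‖(b i).1‖ :=
      (weightL ℂ hκ.memLp_top).le_opNorm (b i).1
    rw [hk.1 i] at h1
    nlinarith [norm_nonneg (b i).1]
  · rw [← weightL_inv_weightedGrad ha (b i)]
    refine (ContinuousLinearMap.le_opNorm _ _).trans ?_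
    have h1 : ‖weightedGrad ha (b i)‖ ≤ √Λ := Real.le_sqrt_of_sq_le (hG i)
    have h2 : C * ‖weightedGrad ha (b i)‖ ≤ C * √Λ := by gcongr
    linarith

end Growth

end ACMS

end

/-! ### Assembly of the error estimates. -/

theorem mainTheorem1
    (Ω ΓR ΓD : Set ACMS.Plane) (hΩ : ACMS.IsLipschitzDomain Ω)
    (hΓ : ACMS.IsBoundarySplitting Ω ΓR ΓD)
    (J : ℕ) (Ωs : Fin J → Set ACMS.Plane) (hΩs : ACMS.IsPartition Ω Ωs)
    (a c : ACMS.Plane → ℝ) (ha : ACMS.IsUniformlyPositive Ω a)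
    (hc : ACMS.IsUniformlyPositive Ω c)
    (ω : ℝ) (hω : 0 < ω) (κ : ACMS.Plane → ℝ) (hκ : ∀ x, κ x = ω / c x)
    (β : ACMS.Plane → ℝ) (hβ : MemLp β ⊤ (μH[1].restrict ΓR))
    (f g : ACMS.Plane → ℂ) (hf : MemLp f 2 (volume.restrict Ω))
    (hg : MemLp g 2 (μH[1].restrict ΓR))
    (b : Fin J → ℕ → ACMS.Triple Ω) (lam : Fin J → ℕ → ℝ)
    (hb : ∀ j, ACMS.IsEigensystem (Ωs j) a κ (b j) (lam j))
    (hlam : ∀ j i, lam j i ≠ 1)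
    (I : Fin J → ℕ) (uB uBS : ACMS.Triple Ω)
    (huB : ACMS.IsGalerkinSolution ΓR a κ ω β f g (ACMS.bubbleSpace b) uB)
    (huBS : ACMS.IsGalerkinSolution ΓR a κ ω β f g (ACMS.bubbleSpaceFin b I) uBS) :
    (∀ j, ∃ m, ACMS.IsLamStar (lam j) (I j) m) ∧
    (∀ j, ∃ m, ACMS.IsLamSharp (lam j) (I j) m) ∧
    (∀ lamStar : Fin J → ℝ, (∀ j, ACMS.IsLamStar (lam j) (I j) (lamStar j)) →
      ∫ x in Ω, ‖(κ x : ℂ) * (uB - uBS).val x‖ ^ 2 ≤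
        ∑ j, 1 / |lamStar j - 1| ^ 2 * ACMS.dataTail (Ωs j) κ (b j) (I j) f) ∧
    (∀ lamSharp : Fin J → ℝ, (∀ j, ACMS.IsLamSharp (lam j) (I j) (lamSharp j)) →
      ∫ x in Ω, ‖(√(a x) : ℂ) • (uB - uBS).grad x‖ ^ 2 ≤
        ∑ j, lamSharp j / |lamSharp j - 1| ^ 2 *
          ACMS.dataTail (Ωs j) κ (b j) (I j) f) := by
  have hκ' : ACMS.IsUniformlyPositive Ω κ := by
    rw [show κ = fun x => ω / c x from funext hκ]
    exact hc.const_div hω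
  have hΓR : ΓR ⊆ frontier Ω := by
    obtain ⟨O, -, rfl⟩ := hΓ.relOpenR
    exact Set.inter_subset_right
  have hgrow := fun j => (hb j).tendsto_atTop ha hκ' hΩ.isOpen.measurableSet
    hΩ.isBounded.measure_lt_top.ne (hΩs.isOpen j) (hΩs.subset j)
  have hmem : ∀ j i, b j i ∈ ACMS.H10 Ω (Ωs j) := fun j i => ((hb j).eigen i).1
  have htest : ∀ {V : Submodule ℂ (ACMS.Triple Ω)} {u : ACMS.Triple Ω},
      ACMS.IsGalerkinSolution ΓR a κ ω β f g V u → ∀ j i, b j i ∈ V →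
      inner ℂ (ACMS.weightedGrad ha (b j i)) (ACMS.weightedGrad ha u) -
        inner ℂ (ACMS.weightedVal hκ' (b j i)) (ACMS.weightedVal hκ' u) =
      inner ℂ (ACMS.weightedVal hκ' (b j i))
        (ACMS.scaledData hκ' (hΩs.isOpen j).measurableSet hf) := fun hu j i hi =>
    ACMS.helmholtz_inner_eq ha hκ' hΓR hΩ.isOpen (hΩs.isOpen j) (hΩs.subset j) hf (hmem j i)
      (hu.2 _ hi)
  have hmain := (ACMS.decoupled ha hκ' hΩs hb).error_le hlam huB.1 huBS.1
    (fun j i => htest huB j i ((le_iSup (fun j => (Submodule.span ℂ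
      (Set.range (b j))).topologicalClosure) j) (ACMS.Decoupled.mem_closure_span j i)))
    (fun j i hi => htest huBS j i ((le_iSup (fun j => Submodule.span ℂ (b j '' {i | i < I j})) j)
      (Submodule.subset_span ⟨i, hi, rfl⟩)))
  have htail := fun j => ACMS.dataTail_eq hκ' (hΩs.isOpen j) (hΩs.subset j) hf (hmem j) (I j)
  refine ⟨fun j => ACMS.exists_isLamStar (hgrow j) _,
    fun j => ACMS.exists_isLamSharp (hgrow j) (hlam j) _, fun lamStar hS => ?_,
    fun lamSharp hS => ?_⟩
  · rw [← ACMS.norm_weightedVal_sq hκ']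
    simp only [htail]
    -- The smallest `|λ - 1|` over the tail gives the largest factor `1 / |λ - 1|²`.
    refine hmain.1 _ fun j i hi => ?_
    obtain ⟨n, -, hn, hmin⟩ := hS j
    rw [← hn]
    have hpos : 0 < |lam j n - 1| := abs_pos.2 (sub_ne_zero.2 (hlam j n))
    exact one_div_le_one_div_of_le (by positivity)
      (pow_le_pow_left₀ hpos.le (hmin (Set.mem_Ici.2 hi)) 2)
  · rw [← ACMS.norm_weightedGrad_sq ha]
    simp only [htail]
    refine hmain.2 _ fun j i hi => ?_
    obtain ⟨n, -, hn, hmax⟩ := hS j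
    rw [← hn]
    exact hmax (Set.mem_Ici.2 hi)
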